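/- For a Borel probability measure $\mu$ on $\mathbb{R}$ put, for $z\in\mathbb{C}^+$ (the upper half-plane), $$G_\mu(z)=\int_{\mathbb{R}}\frac{1}{z-x}\,\mu(dx),\qquad F_\mu(z)=\frac1{G_\mu(z)},\qquad K_\mu(z)=z-F_\mu(z).$$ The Boolean convolution $\mu\uplus\nu$ of probability measures $\mu,\nu$ on $\mathbb{R}$ is the probability measure with $K_{\mu\uplus\nu}=K_\mu+K_\nu$ on $\mathbb{C}^+$. A probability measure $\mu$ on $\mathbb{R}$ is Boolean selfdecomposable if for every $c\in(0,1)$ there is a probability measure $\mu_c$ on $\mathbb{R}$ with $\mu=D_c(\mu)\uplus\mu_c$, where $D_c(\mu)$ is the push-forward of $\mu$ under $x\mapsto cx$. For every probability measure $\mu$ on $\mathbb{R}$ there are a unique $b\in\mathbb{R}$ and a unique finite positive measure $\tau$ on $\mathbb{R}$ with $K_\mu(z)=b+\int_{\mathbb{R}}\frac{1+xz}{z-x}\,\tau(dx)$ for all $z\in\mathbb{C}^+$. The Boolean Lévy measure of $\mu$ is $\nu(dx)=\frac{1+x^2}{x^2}\mathbf{1}_{\mathbb{R}\setminus\{0\}}(x)\,\tau(dx)$,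 and $k_\mu:\mathbb{R}\setminus\{0\}\to[0,\infty)$ is $k_\mu(x)=|x|\,\frac{d\nu^{\mathrm{ac}}}{dx}(x)$, where $\nu^{\mathrm{ac}}$ is the part of $\nu$ that is absolutely continuous with respect to Lebesgue measure; $k_\mu$ is determined up to Lebesgue-null sets. **Theorem.** Let $\mu$ be Boolean selfdecomposable. Then $k_\mu$ has a version that is unimodal with mode $0$, that is, non-decreasing on $(-\infty,0)$ and non-increasing on $(0,\infty)$. Let $k_\mu$ be any such version, suppose that it is not identically zero, and let $$\alpha=\inf\{x\in\mathbb{R}\setminus\{0\}:k_\mu(x)\neq0\},\qquad \beta=\sup\{x\in\mathbb{R}\setminus\{0\}:k_\mu(x)\neq0\}.$$ Then $\alpha\in[-\infty,0]$, $\beta\in[0,\infty]$, and: 1. $\mu|_{(\alpha,\beta)}$ is absolutely continuous with respect to Lebesgue measure. 2. If $\alpha>-\infty$, then $\mu|_{(-\infty,\alpha]}$ is the zero measure or a positive multiple of a Dirac measure. If $\beta<\infty$, then $\mu|_{[\beta,\infty)}$ is the zero measure or a positive multiple of a Dirac measure. 3. $\mu(\{0\})=0$. In particular, $\mu$ has no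 singular continuous part with respect to Lebesgue measure and has at most two atoms. -/

import Mathlib

open MeasureTheory

noncomputable section

/-- The Cauchy transform `G_μ(z) = ∫ 1 / (z - x) μ(dx)`; used on the upper half-plane. -/
def cauchyTransform (μ : Measure ℝ) (z : ℂ) : ℂ :=
  ∫ x : ℝ, 1 / (z - (x : ℂ)) ∂μ

/-- The `F`-transform `F_μ = 1 / G_μ`. -/
def fTransform (μ : Measure ℝ) (z : ℂ) : ℂ :=
  1 / cauchyTransform μ z

/-- The self-energy function `K_μ(z) = z - F_μ(z)`. -/
def selfEnergy (μ : Measure ℝ) (z : ℂ) : ℂ :=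
  z - fTransform μ z

/-- `ρ` is the Boolean convolution `μ ⊎ ν`: the probability measure on `ℝ` with
`K_ρ = K_μ + K_ν` on the upper half-plane. (A probability measure is determined by its
self-energy function.) -/
def IsBooleanConvolution (ρ μ ν : Measure ℝ) : Prop :=
  IsProbabilityMeasure ρ ∧
    ∀ z : ℂ, 0 < z.im → selfEnergy ρ z = selfEnergy μ z + selfEnergy ν z

/-- The dilation `D_c(μ)`, the push-forward of `μ` under `x ↦ c x`. -/
def dilation (c : ℝ) (μ : Measure ℝ) : Measure ℝ :=
  μ.map (fun x => c * x)

/-- `μ` is Boolean selfdecomposable: for every `c ∈ (0,1)` there is a probability measure `μ_c`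
with `μ = D_c(μ) ⊎ μ_c`. -/
def IsBooleanSelfdecomposable (μ : Measure ℝ) : Prop :=
  IsProbabilityMeasure μ ∧
    ∀ c : ℝ, 0 < c → c < 1 →
      ∃ μc : Measure ℝ, IsProbabilityMeasure μc ∧ IsBooleanConvolution μ (dilation c μ) μc

/-- `(b, τ)` is the Boolean generating pair of `μ`: `τ` is a finite measure and
`K_μ(z) = b + ∫ (1 + x z) / (z - x) τ(dx)` on the upper half-plane. -/
def IsBooleanGeneratingPair (μ : Measure ℝ) (b : ℝ) (τ : Measure ℝ) : Prop :=
  IsFiniteMeasure τ ∧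
    ∀ z : ℂ, 0 < z.im →
      selfEnergy μ z = (b : ℂ) + ∫ x : ℝ, (1 + (x : ℂ) * z) / (z - (x : ℂ)) ∂τ

open Classical in
/-- The measure `τ` of the Boolean generating pair `(b, τ)` of `μ`. Every probability measure on
`ℝ` has exactly one generating pair, so for these the default value `0` is never used. -/
def booleanGeneratingMeasure (μ : Measure ℝ) : Measure ℝ :=
  if h : ∃ τ : Measure ℝ, ∃ b : ℝ, IsBooleanGeneratingPair μ b τ then h.choose else 0

/-- The Boolean Lévy measure `ν(dx) = (1 + x²) / x² · 1_{ℝ ∖ {0}}(x) τ(dx)` of `μ`. -/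
def booleanLevyMeasure (μ : Measure ℝ) : Measure ℝ :=
  ((booleanGeneratingMeasure μ).restrict {0}ᶜ).withDensity
    (fun x => ENNReal.ofReal ((1 + x ^ 2) / x ^ 2))

/-- `k_μ(x) = |x| · (dν^ac/dx)(x)`, where `ν^ac` is the absolutely continuous part of the Boolean
Lévy measure `ν` of `μ`. (`Measure.rnDeriv` is the density of the absolutely continuous part in the
Lebesgue decomposition.) Determined up to Lebesgue-null sets; only `x ≠ 0` matters. -/
def booleanK (μ : Measure ℝ) (x : ℝ) : ℝ :=
  |x| * ((booleanLevyMeasure μ).rnDeriv volume x).toReal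

/-- `k : ℝ ∖ {0} → [0, ∞)` is a version of `k_μ` that is unimodal with mode `0`, i.e.
non-decreasing on `(-∞, 0)` and non-increasing on `(0, ∞)`. The value `k 0` is irrelevant. -/
def IsUnimodalVersion (μ : Measure ℝ) (k : ℝ → ℝ) : Prop :=
  (∀ x, x ≠ 0 → 0 ≤ k x) ∧ k =ᵐ[volume] booleanK μ ∧
    MonotoneOn k (Set.Iio 0) ∧ AntitoneOn k (Set.Ioi 0)

/-- `inf {x : k x ≠ 0}` in `[-∞, ∞]`, for a function `k` on `ℝ ∖ {0}`. -/
def leftEnd (k : ℝ → ℝ) : EReal :=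
  sInf ((fun x : ℝ => (x : EReal)) '' {x : ℝ | x ≠ 0 ∧ k x ≠ 0})

/-- `sup {x : k x ≠ 0}` in `[-∞, ∞]`, for a function `k` on `ℝ ∖ {0}`. -/
def rightEnd (k : ℝ → ℝ) : EReal :=
  sSup ((fun x : ℝ => (x : EReal)) '' {x : ℝ | x ≠ 0 ∧ k x ≠ 0})

/-- `μ` is the zero measure or a positive multiple of a Dirac measure. -/
def IsZeroOrPointMass (μ : Measure ℝ) : Prop :=
  μ = 0 ∨ ∃ (x : ℝ) (m : ENNReal), m ≠ 0 ∧ μ = m • Measure.dirac x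

/-- The set of atoms of `μ`. -/
def atoms (μ : Measure ℝ) : Set ℝ :=
  {x : ℝ | μ {x} ≠ 0}

/-- The singular continuous part of `μ` with respect to Lebesgue measure: the singular part of
`μ` with its atoms removed. -/
def singularContinuousPart (μ : Measure ℝ) : Measure ℝ :=
  (μ.singularPart volume).restrict (atoms μ)ᶜ

end

open Filter Set Topology Metric
open scoped ENNReal

noncomputable section

/-! Write σ = (1 + x²) τ for a generating pair (b, τ) of μ, and P_ρ for the Poisson integral of ρ.
Then -Im G_μ = P_μ and -Im K_μ = P_σ. Since G F = 1 and -Im K ≤ Im F ≤ |F|, one gets P_μ P_σ ≤ 1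
(`poissonTransform_mul_le_one`): wherever σ is large, μ is small.

Selfdecomposability says that K_μ(z) - c K_μ(z/c) is a self-energy, so its imaginary part is
nonpositive. Hence P of c² D_c(σ) is at most P_σ, and Stieltjes inversion gives c² D_c(σ) ≤ σ on
closed balls. Dividing by lengths, the upper density d of σ satisfies c d(x/c) ≤ d(x) at every x, so
d(x)/|x| decreases away from 0; it is the unimodal version of k. Moreover d is finite off 0, so σ
has no singular part there.

Near a nonzero point of (α, β) the density |x| k(x) of σ is bounded below, so P_μ is bounded above
on short vertical segments and μ is dominated by a multiple of Lebesgue measure on small balls: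
absolute continuity. An atom at p satisfies μ{p} ∫ (p - x)⁻² dσ ≤ 1; at p = 0 the integral dominates
∫ k(x)/|x| dx = ∞, so there is no atom at 0.

Beyond a finite end e, τ has no mass. There F_μ has real boundary values, strictly increasing, hence
vanishing at most once. Where the boundary value is nonzero, P_μ tends to 0 and μ has no mass. The
point e itself fits this scheme, or else its inverse square integral is infinite and excludes an
atom.

Existence of (b, τ) is obtained from the Herglotz representation on the disc, moved by the Cayley
transform. Uniqueness is not needed: each step holds for whichever pair is chosen. -/

/-! ### Cauchy transform and self-energy on the upper half-plane -/

lemma sub_ofReal_ne_zero {z : ℂ} (hz : 0 < z.im) (x : ℝ) : z - (x : ℂ) ≠ 0 := by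
  intro h
  have := congrArg Complex.im h
  simp at this
  exact hz.ne' this

lemma normSq_sub_ofReal (z : ℂ) (x : ℝ) :
    Complex.normSq (z - (x : ℂ)) = (z.re - x) ^ 2 + z.im ^ 2 := by
  simp [Complex.normSq_apply]; ring

lemma normSq_sub_ofReal_pos {z : ℂ} (hz : 0 < z.im) (x : ℝ) :
    0 < Complex.normSq (z - (x : ℂ)) :=
  Complex.normSq_pos.2 (sub_ofReal_ne_zero hz x)

lemma continuous_one_div_sub_ofReal {z : ℂ} (hz : 0 < z.im) :
    Continuous (fun x : ℝ => 1 / (z - (x : ℂ))) :=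
  continuous_const.div (by fun_prop) (sub_ofReal_ne_zero hz)

lemma im_le_norm_sub_ofReal (z : ℂ) (x : ℝ) : z.im ≤ ‖z - (x : ℂ)‖ := by
  have := Complex.abs_im_le_norm (z - (x : ℂ))
  simp at this
  exact (le_abs_self _).trans this

lemma integrable_one_div_sub_ofReal (μ : Measure ℝ) [IsFiniteMeasure μ] {z : ℂ} (hz : 0 < z.im) :
    Integrable (fun x : ℝ => 1 / (z - (x : ℂ))) μ := by
  refine Integrable.of_bound (continuous_one_div_sub_ofReal hz).aestronglyMeasurable (1 / z.im)
    (ae_of_all _ fun x => ?_)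
  rw [norm_div, norm_one]
  exact one_div_le_one_div_of_le hz (im_le_norm_sub_ofReal z x)

/-- The Poisson integral `∫ y / |z - x|² ρ(dx)`, `y = Im z`, of a positive measure. -/
def poissonTransform (ρ : Measure ℝ) (z : ℂ) : ℝ≥0∞ :=
  ∫⁻ x : ℝ, ENNReal.ofReal (z.im / Complex.normSq (z - (x : ℂ))) ∂ρ

lemma continuous_poisson_kernel {z : ℂ} (hz : 0 < z.im) :
    Continuous (fun x : ℝ => z.im / Complex.normSq (z - (x : ℂ))) :=
  continuous_const.div (Complex.continuous_normSq.comp (by fun_prop))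
    fun x => (normSq_sub_ofReal_pos hz x).ne'

lemma im_one_div_sub_ofReal (z : ℂ) (x : ℝ) :
    (1 / (z - (x : ℂ))).im = -(z.im / Complex.normSq (z - (x : ℂ))) := by
  rw [one_div, Complex.inv_im]; simp [neg_div]

lemma neg_im_cauchyTransform_eq (μ : Measure ℝ) [IsFiniteMeasure μ] {z : ℂ} (hz : 0 < z.im) :
    -(cauchyTransform μ z).im = ∫ x : ℝ, z.im / Complex.normSq (z - (x : ℂ)) ∂μ := by
  have h1 := integral_im (integrable_one_div_sub_ofReal μ hz)
  simp only [RCLike.im_to_complex] at h1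
  rw [cauchyTransform, ← h1, ← integral_neg]
  congr 1; ext x
  rw [im_one_div_sub_ofReal, neg_neg]

lemma integrable_poisson_kernel (μ : Measure ℝ) [IsFiniteMeasure μ] {z : ℂ} (hz : 0 < z.im) :
    Integrable (fun x : ℝ => z.im / Complex.normSq (z - (x : ℂ))) μ := by
  refine (integrable_one_div_sub_ofReal μ hz).im.neg.congr (ae_of_all _ fun x => ?_)
  have := im_one_div_sub_ofReal z x
  simp only [Pi.neg_apply, RCLike.im_to_complex, this, neg_neg]

lemma ofReal_neg_im_cauchyTransform (μ : Measure ℝ) [IsFiniteMeasure μ] {z : ℂ} (hz : 0 < z.im) :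
    ENNReal.ofReal (-(cauchyTransform μ z).im) = poissonTransform μ z := by
  rw [neg_im_cauchyTransform_eq μ hz, ofReal_integral_eq_lintegral_ofReal
    (integrable_poisson_kernel μ hz)
    (ae_of_all _ fun x => div_nonneg hz.le (Complex.normSq_nonneg _)), poissonTransform]

/-- The Cauchy–Schwarz inequality `Im z · |G(z)|² ≤ -Im G(z)`. -/
lemma im_mul_normSq_cauchyTransform_le (μ : Measure ℝ) [IsProbabilityMeasure μ] {z : ℂ}
    (hz : 0 < z.im) :
    z.im * Complex.normSq (cauchyTransform μ z) ≤ -(cauchyTransform μ z).im := by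
  set g := cauchyTransform μ z with hg
  have hi := integrable_one_div_sub_ofReal μ hz
  have hP := integrable_poisson_kernel μ hz
  have hre : ∫ x : ℝ, (1 / (z - (x : ℂ))).re ∂μ = g.re := integral_re hi
  have him : ∫ x : ℝ, (1 / (z - (x : ℂ))).im ∂μ = g.im := integral_im hi
  have hir : Integrable (fun x : ℝ => (1 / (z - (x : ℂ))).re) μ := hi.re
  have hii : Integrable (fun x : ℝ => (1 / (z - (x : ℂ))).im) μ := hi.im
  -- The integrand is Im z · |1/(z - x) - G(z)|², expanded: a variance.
  have key : ∫ x : ℝ, (z.im / Complex.normSq (z - (x : ℂ))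
      - 2 * z.im * (g.re * (1 / (z - (x : ℂ))).re + g.im * (1 / (z - (x : ℂ))).im)
      + z.im * Complex.normSq g) ∂μ ≥ 0 := by
    refine integral_nonneg fun x => ?_
    have h1 : z.im / Complex.normSq (z - (x : ℂ)) =
        z.im * Complex.normSq (1 / (z - (x : ℂ))) := by
      simp [div_eq_mul_inv]
    simp only [Pi.zero_apply]
    rw [h1, Complex.normSq_apply, Complex.normSq_apply]
    set w := 1 / (z - (x : ℂ))
    nlinarith [mul_nonneg hz.le (sq_nonneg (w.re - g.re)),
      mul_nonneg hz.le (sq_nonneg (w.im - g.im))]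
  have hs : Integrable (fun x : ℝ => g.re * (1 / (z - (x : ℂ))).re +
      g.im * (1 / (z - (x : ℂ))).im) μ := (hir.const_mul _).add (hii.const_mul _)
  have hd : Integrable (fun x : ℝ => z.im / Complex.normSq (z - (x : ℂ)) - 2 * z.im *
      (g.re * (1 / (z - (x : ℂ))).re + g.im * (1 / (z - (x : ℂ))).im)) μ :=
    hP.sub (hs.const_mul _)
  rw [integral_add hd (integrable_const _), integral_sub hP (hs.const_mul _),
    integral_const_mul, integral_add (hir.const_mul _) (hii.const_mul _),
    integral_const_mul, integral_const_mul, hre, him, ← neg_im_cauchyTransform_eq μ hz] at key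
  simp only [integral_const, probReal_univ, one_smul] at key
  rw [Complex.normSq_apply] at key ⊢
  linarith

lemma cauchyTransform_im_neg (μ : Measure ℝ) [IsProbabilityMeasure μ] {z : ℂ} (hz : 0 < z.im) :
    (cauchyTransform μ z).im < 0 := by
  have h : 0 < -(cauchyTransform μ z).im := by
    rw [neg_im_cauchyTransform_eq μ hz, integral_pos_iff_support_of_nonneg
      (fun x => div_nonneg hz.le (Complex.normSq_nonneg _)) (integrable_poisson_kernel μ hz)]
    have : Function.support (fun x : ℝ => z.im / Complex.normSq (z - (x : ℂ))) = univ := by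
      ext x; simpa using (div_pos hz (normSq_sub_ofReal_pos hz x)).ne'
    rw [this]; simp
  linarith

lemma cauchyTransform_ne_zero (μ : Measure ℝ) [IsProbabilityMeasure μ] {z : ℂ} (hz : 0 < z.im) :
    cauchyTransform μ z ≠ 0 := fun h => by
  have := cauchyTransform_im_neg μ hz
  simp [h] at this

lemma im_le_im_fTransform (μ : Measure ℝ) [IsProbabilityMeasure μ] {z : ℂ} (hz : 0 < z.im) :
    z.im ≤ (fTransform μ z).im := by
  rw [fTransform, one_div, Complex.inv_im,
    le_div_iff₀ (Complex.normSq_pos.2 (cauchyTransform_ne_zero μ hz))]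
  exact im_mul_normSq_cauchyTransform_le μ hz

lemma selfEnergy_im_nonpos (μ : Measure ℝ) [IsProbabilityMeasure μ] {z : ℂ} (hz : 0 < z.im) :
    (selfEnergy μ z).im ≤ 0 := by
  rw [selfEnergy, Complex.sub_im]
  linarith [im_le_im_fTransform μ hz]

lemma cauchyTransform_dilation (μ : Measure ℝ) {c : ℝ} (hc : 0 < c) (z : ℂ) :
    cauchyTransform (dilation c μ) z = cauchyTransform μ (z / c) / c := by
  have hc' : (c : ℂ) ≠ 0 := by exact_mod_cast hc.ne'
  rw [cauchyTransform, dilation, integral_map (by fun_prop)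
    (by exact Measurable.aestronglyMeasurable (by fun_prop)), cauchyTransform,
    ← integral_div]
  congr 1; ext x
  push_cast
  have : z - c * x = c * (z / c - x) := by field_simp
  rw [this, div_div, mul_comm (c : ℂ)]

lemma selfEnergy_dilation (μ : Measure ℝ) {c : ℝ} (hc : 0 < c) (z : ℂ) :
    selfEnergy (dilation c μ) z = c * selfEnergy μ (z / c) := by
  have hc' : (c : ℂ) ≠ 0 := by exact_mod_cast hc.ne'
  rw [selfEnergy, selfEnergy, fTransform, fTransform, cauchyTransform_dilation μ hc, mul_sub,
    mul_div_cancel₀ _ hc', one_div_div, mul_one_div]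

/-! ### The generating pair and the Poisson integral of (1 + x²) τ -/

/-- The measure `(1 + x²) τ(dx)`. -/
def tilted (τ : Measure ℝ) : Measure ℝ :=
  τ.withDensity (fun x => ENNReal.ofReal (1 + x ^ 2))

lemma tilted_kernel_im {z : ℂ} (hz : 0 < z.im) (x : ℝ) :
    ((1 + (x : ℂ) * z) / (z - (x : ℂ))).im =
      -((1 + x ^ 2) * (z.im / Complex.normSq (z - (x : ℂ)))) := by
  have h := (normSq_sub_ofReal_pos hz x).ne'
  have hn := normSq_sub_ofReal z x
  rw [Complex.div_im]
  simp
  field_simp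
  ring

lemma continuous_tilted_kernel {z : ℂ} (hz : 0 < z.im) :
    Continuous (fun x : ℝ => (1 + (x : ℂ) * z) / (z - (x : ℂ))) :=
  Continuous.div (by fun_prop) (by fun_prop) (sub_ofReal_ne_zero hz)

lemma tilted_kernel_eq {z : ℂ} (hz : 0 < z.im) (x : ℝ) :
    (1 + (x : ℂ) * z) / (z - (x : ℂ)) = -z + (1 + z ^ 2) * (1 / (z - (x : ℂ))) := by
  have := sub_ofReal_ne_zero hz x
  field_simp
  ring

lemma integrable_tilted_kernel (τ : Measure ℝ) [IsFiniteMeasure τ] {z : ℂ} (hz : 0 < z.im) :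
    Integrable (fun x : ℝ => (1 + (x : ℂ) * z) / (z - (x : ℂ))) τ := by
  simp_rw [tilted_kernel_eq hz]
  exact (integrable_const _).add ((integrable_one_div_sub_ofReal τ hz).const_mul _)

lemma neg_im_selfEnergy_eq {μ τ : Measure ℝ} {b : ℝ} (h : IsBooleanGeneratingPair μ b τ) {z : ℂ}
    (hz : 0 < z.im) :
    -(selfEnergy μ z).im = ∫ x : ℝ, (1 + x ^ 2) * (z.im / Complex.normSq (z - (x : ℂ))) ∂τ := by
  have := h.1
  have h1 := integral_im (integrable_tilted_kernel τ hz)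
  simp only [RCLike.im_to_complex] at h1
  rw [h.2 z hz, Complex.add_im, Complex.ofReal_im, zero_add, ← h1, ← integral_neg]
  congr 1; ext x
  rw [tilted_kernel_im hz, neg_neg]

lemma lintegral_tilted (τ : Measure ℝ) {f : ℝ → ℝ≥0∞} (hf : Measurable f) :
    ∫⁻ x, f x ∂(tilted τ) = ∫⁻ x, ENNReal.ofReal (1 + x ^ 2) * f x ∂τ := by
  rw [tilted, lintegral_withDensity_eq_lintegral_mul _ (by fun_prop) hf]; rfl

lemma measurable_poisson_kernel {z : ℂ} (hz : 0 < z.im) :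
    Measurable (fun x : ℝ => ENNReal.ofReal (z.im / Complex.normSq (z - (x : ℂ)))) :=
  (continuous_poisson_kernel hz).measurable.ennreal_ofReal

lemma ofReal_neg_im_selfEnergy {μ τ : Measure ℝ} {b : ℝ} (h : IsBooleanGeneratingPair μ b τ)
    {z : ℂ} (hz : 0 < z.im) :
    ENNReal.ofReal (-(selfEnergy μ z).im) = poissonTransform (tilted τ) z := by
  have := h.1
  rw [neg_im_selfEnergy_eq h hz, ofReal_integral_eq_lintegral_ofReal, poissonTransform,
    lintegral_tilted τ (measurable_poisson_kernel hz)]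
  · congr 1; ext x
    rw [ENNReal.ofReal_mul (by positivity)]
  · refine (integrable_tilted_kernel τ hz).im.neg.congr (ae_of_all _ fun x => ?_)
    have := tilted_kernel_im hz x
    simp only [Pi.neg_apply, RCLike.im_to_complex, this, neg_neg]
  · exact ae_of_all _ fun x => mul_nonneg (by positivity)
      (div_nonneg hz.le (Complex.normSq_nonneg _))

lemma poissonTransform_tilted_ne_top {μ τ : Measure ℝ} {b : ℝ}
    (h : IsBooleanGeneratingPair μ b τ) {z : ℂ} (hz : 0 < z.im) :
    poissonTransform (tilted τ) z ≠ ∞ := by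
  rw [← ofReal_neg_im_selfEnergy h hz]; exact ENNReal.ofReal_ne_top

/-- The product is Im G · Im K, at most |G| |F| = 1 because -Im K = Im F - Im z ≤ |F|. -/
lemma poissonTransform_mul_le_one {μ τ : Measure ℝ} {b : ℝ} [IsProbabilityMeasure μ]
    (h : IsBooleanGeneratingPair μ b τ) {z : ℂ} (hz : 0 < z.im) :
    poissonTransform μ z * poissonTransform (tilted τ) z ≤ 1 := by
  have hG := cauchyTransform_im_neg μ hz
  have hK := selfEnergy_im_nonpos μ hz
  rw [← ofReal_neg_im_cauchyTransform μ hz, ← ofReal_neg_im_selfEnergy h hz,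
    ← ENNReal.ofReal_mul (by linarith), ← ENNReal.ofReal_one]
  refine ENNReal.ofReal_le_ofReal ?_
  have hF : -(selfEnergy μ z).im ≤ (fTransform μ z).im := by
    rw [selfEnergy, Complex.sub_im]; linarith
  have h1 : -(selfEnergy μ z).im ≤ ‖fTransform μ z‖ :=
    hF.trans ((le_abs_self _).trans (Complex.abs_im_le_norm _))
  have h2 : -(cauchyTransform μ z).im ≤ ‖cauchyTransform μ z‖ :=
    (neg_le_abs _).trans (Complex.abs_im_le_norm _)
  calc _ ≤ ‖cauchyTransform μ z‖ * ‖fTransform μ z‖ :=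
        mul_le_mul h2 h1 (by linarith) (norm_nonneg _)
    _ = 1 := by
        rw [← norm_mul, fTransform, mul_one_div_cancel (cauchyTransform_ne_zero μ hz), norm_one]

/-- The scaled measure `c² D_c(σ)` has Poisson integral `c · P_σ(z / c)`. -/
lemma poissonTransform_smul_dilation (σ : Measure ℝ) {c : ℝ} (hc : 0 < c) {z : ℂ}
    (hz : 0 < z.im) :
    poissonTransform (ENNReal.ofReal (c ^ 2) • dilation c σ) z =
      ENNReal.ofReal c * poissonTransform σ (z / c) := by
  have hzc : 0 < (z / (c : ℂ)).im := by rw [Complex.div_ofReal_im]; positivity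
  rw [poissonTransform, lintegral_smul_measure, dilation,
    lintegral_map (measurable_poisson_kernel hz) (by fun_prop), poissonTransform, smul_eq_mul,
    ← lintegral_const_mul _ (by have := measurable_poisson_kernel hz; fun_prop),
    ← lintegral_const_mul _ (measurable_poisson_kernel hzc)]
  congr 1; ext x
  rw [← ENNReal.ofReal_mul (by positivity), ← ENNReal.ofReal_mul hc.le]
  congr 1
  have h1 := normSq_sub_ofReal_pos hz (c * x)
  have h2 := normSq_sub_ofReal_pos hzc x
  have h3 : Complex.normSq (z - ((c * x : ℝ) : ℂ)) =
      c ^ 2 * Complex.normSq (z / (c : ℂ) - (x : ℂ)) := by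
    rw [normSq_sub_ofReal, normSq_sub_ofReal, Complex.div_ofReal_im, Complex.div_ofReal_re]
    field_simp
  rw [h3, Complex.div_ofReal_im]
  field_simp

/-- For a Boolean selfdecomposable measure, `P_{c² D_c(σ)} ≤ P_σ`. -/
lemma IsBooleanSelfdecomposable.poissonTransform_le {μ τ : Measure ℝ} {b : ℝ}
    (hμ : IsBooleanSelfdecomposable μ) (h : IsBooleanGeneratingPair μ b τ) {c : ℝ} (hc : 0 < c)
    (hc1 : c < 1) {z : ℂ} (hz : 0 < z.im) :
    poissonTransform (ENNReal.ofReal (c ^ 2) • dilation c (tilted τ)) z ≤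
      poissonTransform (tilted τ) z := by
  have hzc : 0 < (z / (c : ℂ)).im := by rw [Complex.div_ofReal_im]; positivity
  obtain ⟨μc, hp, hconv⟩ := hμ.2 c hc hc1
  rw [poissonTransform_smul_dilation _ hc hz, ← ofReal_neg_im_selfEnergy h hz,
    ← ofReal_neg_im_selfEnergy h hzc, ← ENNReal.ofReal_mul hc.le]
  refine ENNReal.ofReal_le_ofReal ?_
  -- Imaginary parts of K_μ(z) = c K_μ(z/c) + K_{μ_c}(z); the last one is nonpositive and can be
  -- dropped.
  have h1 := congrArg Complex.im (hconv.2 z hz)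
  rw [selfEnergy_dilation μ hc, Complex.add_im, Complex.im_ofReal_mul] at h1
  have h2 := selfEnergy_im_nonpos μc hz
  linarith

/-! ### Stieltjes inversion as a comparison of measures -/

lemma lintegral_poisson_kernel_Ioo {a b y : ℝ} (hab : a ≤ b) (hy : 0 < y) (x : ℝ) :
    ∫⁻ u in Ioo a b, ENNReal.ofReal (y / ((u - x) ^ 2 + y ^ 2)) =
      ENNReal.ofReal (Real.arctan ((b - x) / y) - Real.arctan ((a - x) / y)) := by
  have hcont : Continuous (fun u : ℝ => y / ((u - x) ^ 2 + y ^ 2)) :=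
    continuous_const.div (by fun_prop) fun u => by positivity
  have hder : ∀ u : ℝ, HasDerivAt (fun u => Real.arctan ((u - x) / y))
      (y / ((u - x) ^ 2 + y ^ 2)) u := by
    intro u
    have h := (((hasDerivAt_id' u).sub_const x).div_const y).arctan
    convert h using 1
    field_simp
    ring
  have hint : IntervalIntegrable (fun u : ℝ => y / ((u - x) ^ 2 + y ^ 2)) volume a b :=
    hcont.intervalIntegrable a b
  rw [← intervalIntegral.integral_eq_sub_of_hasDerivAt (fun u _ => hder u) hint,
    intervalIntegral.integral_of_le hab, integral_Ioc_eq_integral_Ioo,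
    ofReal_integral_eq_lintegral_ofReal]
  · exact ((intervalIntegrable_iff_integrableOn_Ioo_of_le hab).1 hint)
  · exact ae_of_all _ fun u => by positivity

lemma lintegral_poissonTransform_Ioo (σ : Measure ℝ) [SFinite σ] {a b y : ℝ} (hab : a ≤ b)
    (hy : 0 < y) :
    ∫⁻ u in Ioo a b, poissonTransform σ ⟨u, y⟩ =
      ∫⁻ x, ENNReal.ofReal (Real.arctan ((b - x) / y) - Real.arctan ((a - x) / y)) ∂σ := by
  simp only [poissonTransform, normSq_sub_ofReal]
  rw [lintegral_lintegral_swap]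
  · congr 1; ext x
    exact lintegral_poisson_kernel_Ioo hab hy x
  · exact Measurable.aemeasurable (by fun_prop)

lemma tendsto_arctan_div_nhdsGT_zero (t : ℝ) :
    Tendsto (fun y : ℝ => Real.arctan (t / y)) (𝓝[>] 0) (𝓝 (Real.pi / 2 * Real.sign t)) := by
  rcases lt_trichotomy t 0 with h | h | h
  · rw [Real.sign_of_neg h]
    have h1 : Tendsto (fun y : ℝ => t * y⁻¹) (𝓝[>] 0) atBot :=
      tendsto_inv_nhdsGT_zero.const_mul_atTop_of_neg h
    have := (Real.tendsto_arctan_atBot.mono_right nhdsWithin_le_nhds).comp h1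
    simpa [Function.comp_def, div_eq_mul_inv] using this
  · simp [h]
  · rw [Real.sign_of_pos h]
    have h1 : Tendsto (fun y : ℝ => t * y⁻¹) (𝓝[>] 0) atTop :=
      tendsto_inv_nhdsGT_zero.const_mul_atTop h
    have := (Real.tendsto_arctan_atTop.mono_right nhdsWithin_le_nhds).comp h1
    simpa [Function.comp_def, div_eq_mul_inv] using this

/-- A majorant uniform in y ≤ 1 for dominated convergence; 1/(1 + x²) is the Poisson kernel at i, so
it is integrable whenever the Poisson integral at i is finite. -/
lemma arctan_sub_arctan_le {a b : ℝ} (hab : a ≤ b) : ∃ C : ℝ, 0 ≤ C ∧ ∀ y : ℝ, 0 < y → y ≤ 1 →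
    ∀ x : ℝ, ENNReal.ofReal (Real.arctan ((b - x) / y) - Real.arctan ((a - x) / y)) ≤
      ENNReal.ofReal (C * (1 / (1 + x ^ 2))) := by
  set M := |a| + |b| with hM
  have hM0 : 0 ≤ M := by positivity
  -- For |x| > R every u in (a, b) has |u - x| ≥ |x|/2, and x² ≥ 1 gives 4/x² ≤ 8/(1 + x²). For |x|
  -- ≤ R the trivial bound π suffices.
  set R := 2 * M + 1 with hR
  refine ⟨Real.pi * (1 + R ^ 2) + 8 * (b - a), by
    have := Real.pi_pos; have := sub_nonneg.2 hab; positivity, fun y hy hy1 x => ?_⟩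
  have hba := sub_nonneg.2 hab
  rcases le_or_gt |x| R with hx | hx
  · refine ENNReal.ofReal_le_ofReal ?_
    have h1 := Real.arctan_lt_pi_div_two ((b - x) / y)
    have h2 := Real.neg_pi_div_two_lt_arctan ((a - x) / y)
    have hxR : x ^ 2 ≤ R ^ 2 := by rw [← sq_abs x]; gcongr
    have h3 : Real.pi ≤ (Real.pi * (1 + R ^ 2) + 8 * (b - a)) * (1 / (1 + x ^ 2)) := by
      rw [mul_one_div, le_div_iff₀ (by positivity)]
      nlinarith [Real.pi_pos]
    linarith
  · rw [← lintegral_poisson_kernel_Ioo hab hy x]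
    calc _ ≤ ∫⁻ u in Ioo a b, ENNReal.ofReal (8 * (1 / (1 + x ^ 2))) := by
          refine setLIntegral_mono (by fun_prop) fun u hu => ENNReal.ofReal_le_ofReal ?_
          have hu : |u| ≤ M := by
            rw [abs_le]
            have := neg_abs_le a; have := le_abs_self b
            have := abs_nonneg a; have := abs_nonneg b
            constructor <;> linarith [hu.1, hu.2]
          have h1 : |x| / 2 ≤ |u - x| := by
            have := abs_sub_abs_le_abs_sub x u
            rw [abs_sub_comm] at this
            linarith
          have h2 : (|x| / 2) ^ 2 ≤ (u - x) ^ 2 := by rw [← sq_abs (u - x)]; gcongr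
          have h3 : 1 ≤ x ^ 2 := by
            rw [← sq_abs x]; nlinarith
          rw [div_pow, sq_abs] at h2
          rw [mul_one_div, div_le_div_iff₀ (by positivity) (by positivity)]
          nlinarith [mul_nonneg (sub_nonneg.2 hy1) (by positivity : 0 ≤ 1 + x ^ 2), sq_nonneg y]
      _ = ENNReal.ofReal (8 * (1 / (1 + x ^ 2)) * (b - a)) := by
          rw [setLIntegral_const, Real.volume_Ioo, ← ENNReal.ofReal_mul (by positivity)]
      _ ≤ _ := by
          refine ENNReal.ofReal_le_ofReal ?_
          have := Real.pi_pos
          have h4 : 0 ≤ Real.pi * (1 + R ^ 2) * (1 / (1 + x ^ 2)) := by positivity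
          nlinarith

/-- For a < b the limiting integrand is π on (a, b), π/2 at the two endpoints and 0 outside [a, b].
-/
lemma tendsto_lintegral_arctan {σ : Measure ℝ} (hσ : poissonTransform σ Complex.I ≠ ∞) {a b : ℝ}
    (hab : a ≤ b) :
    Tendsto (fun y : ℝ => ∫⁻ x, ENNReal.ofReal
        (Real.arctan ((b - x) / y) - Real.arctan ((a - x) / y)) ∂σ) (𝓝[>] 0)
      (𝓝 (∫⁻ x, ENNReal.ofReal
        (Real.pi / 2 * Real.sign (b - x) - Real.pi / 2 * Real.sign (a - x)) ∂σ)) := by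
  obtain ⟨C, hC0, hC⟩ := arctan_sub_arctan_le hab
  refine tendsto_lintegral_filter_of_dominated_convergence
    (fun x => ENNReal.ofReal (C * (1 / (1 + x ^ 2)))) ?_ ?_ ?_ ?_
  · exact Eventually.of_forall fun y => by fun_prop
  · filter_upwards [Ioc_mem_nhdsGT one_pos] with y hy
    exact ae_of_all _ (hC y hy.1 hy.2)
  · have : ∀ x : ℝ, ENNReal.ofReal (C * (1 / (1 + x ^ 2))) = ENNReal.ofReal C *
        ENNReal.ofReal (Complex.I.im / Complex.normSq (Complex.I - (x : ℂ))) := by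
      intro x
      rw [ENNReal.ofReal_mul hC0, normSq_sub_ofReal]
      simp [add_comm]
    simp_rw [this]
    rw [lintegral_const_mul' _ _ ENNReal.ofReal_ne_top]
    exact ENNReal.mul_ne_top ENNReal.ofReal_ne_top hσ
  · exact ae_of_all _ fun x => ENNReal.tendsto_ofReal
      ((tendsto_arctan_div_nhdsGT_zero _).sub (tendsto_arctan_div_nhdsGT_zero _))

/-- Stieltjes inversion as a comparison of measures on intervals. -/
lemma measure_Ioo_le_of_poissonTransform_le {σ₁ σ₂ : Measure ℝ} [SFinite σ₁] [SFinite σ₂]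
    (h₂ : poissonTransform σ₂ Complex.I ≠ ∞)
    (hle : ∀ z : ℂ, 0 < z.im → poissonTransform σ₁ z ≤ poissonTransform σ₂ z) {a b : ℝ}
    (hab : a ≤ b) :
    σ₁ (Ioo a b) ≤ σ₂ (Icc a b) := by
  have h₁ : poissonTransform σ₁ Complex.I ≠ ∞ := ne_top_of_le_ne_top h₂ (hle _ (by simp))
  have hlim := le_of_tendsto_of_tendsto (tendsto_lintegral_arctan h₁ hab)
    (tendsto_lintegral_arctan h₂ hab) (by
      filter_upwards [self_mem_nhdsWithin] with y hy
      rw [← lintegral_poissonTransform_Ioo σ₁ hab hy, ← lintegral_poissonTransform_Ioo σ₂ hab hy]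
      exact lintegral_mono fun u => hle _ hy)
  have hpi : ENNReal.ofReal Real.pi ≠ 0 := by simpa using Real.pi_pos
  rw [← ENNReal.mul_le_mul_iff_right hpi ENNReal.ofReal_ne_top]
  -- The endpoint values π/2 are discarded on the left and rounded up to π on the right, hence open
  -- against closed interval.
  calc ENNReal.ofReal Real.pi * σ₁ (Ioo a b)
      = ∫⁻ x in Ioo a b, ENNReal.ofReal Real.pi ∂σ₁ := by rw [setLIntegral_const]
    _ ≤ ∫⁻ x in Ioo a b, ENNReal.ofReal
        (Real.pi / 2 * Real.sign (b - x) - Real.pi / 2 * Real.sign (a - x)) ∂σ₁ := by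
        refine setLIntegral_mono' measurableSet_Ioo fun x hx => ENNReal.ofReal_le_ofReal ?_
        rw [Real.sign_of_pos (sub_pos.2 hx.2), Real.sign_of_neg (sub_neg.2 hx.1)]
        linarith
    _ ≤ _ := setLIntegral_le_lintegral _ _
    _ ≤ _ := hlim
    _ ≤ ∫⁻ x, (Icc a b).indicator (fun _ => ENNReal.ofReal Real.pi) x ∂σ₂ := by
        refine lintegral_mono fun x => ?_
        by_cases hx : x ∈ Icc a b
        · rw [indicator_of_mem hx]
          refine ENNReal.ofReal_le_ofReal ?_
          have h3 : Real.sign (b - x) ≤ 1 := by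
            rcases Real.sign_apply_eq (b - x) with h | h | h <;> rw [h] <;> norm_num
          have h4 : -1 ≤ Real.sign (a - x) := by
            rcases Real.sign_apply_eq (a - x) with h | h | h <;> rw [h] <;> norm_num
          nlinarith [Real.pi_pos]
        · rw [indicator_of_notMem hx]
          rcases not_and_or.1 hx with h | h
          · rw [Real.sign_of_pos (by linarith : 0 < b - x), Real.sign_of_pos (by linarith)]; simp
          · rw [Real.sign_of_neg (by linarith : b - x < 0), Real.sign_of_neg (by linarith)]; simp
    _ = ENNReal.ofReal Real.pi * σ₂ (Icc a b) := by
        rw [lintegral_indicator measurableSet_Icc, setLIntegral_const]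

/-- Apply the open-closed comparison to slightly larger intervals and shrink them; continuity from
above needs `σ₂` finite on compacts. -/
lemma measure_Icc_le_of_poissonTransform_le {σ₁ σ₂ : Measure ℝ} [SFinite σ₁] [SFinite σ₂]
    [IsLocallyFiniteMeasure σ₂] (h₂ : poissonTransform σ₂ Complex.I ≠ ∞)
    (hle : ∀ z : ℂ, 0 < z.im → poissonTransform σ₁ z ≤ poissonTransform σ₂ z) {a b : ℝ}
    (hab : a ≤ b) :
    σ₁ (Icc a b) ≤ σ₂ (Icc a b) := by
  have hbound : ∀ n : ℕ, σ₁ (Icc a b) ≤ σ₂ (Icc (a - 1 / (n + 1)) (b + 1 / (n + 1))) := by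
    intro n
    have hn : (0 : ℝ) < 1 / (n + 1) := by positivity
    exact (measure_mono (Icc_subset_Ioo (by linarith) (by linarith))).trans
      (measure_Ioo_le_of_poissonTransform_le h₂ hle (by linarith))
  have hInter : ⋂ n : ℕ, Icc (a - 1 / ((n : ℝ) + 1)) (b + 1 / ((n : ℝ) + 1)) = Icc a b := by
    have hn := tendsto_one_div_add_atTop_nhds_zero_nat (𝕜 := ℝ)
    ext x
    simp only [mem_iInter, mem_Icc]
    refine ⟨fun h => ⟨?_, ?_⟩, fun h n => ?_⟩
    · have := le_of_tendsto_of_tendsto' (tendsto_const_nhds.sub hn) tendsto_const_nhds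
        fun n => (h n).1
      simpa using this
    · have := le_of_tendsto_of_tendsto' tendsto_const_nhds (tendsto_const_nhds.add hn)
        fun n => (h n).2
      simpa using this
    · have hn : (0 : ℝ) < 1 / (n + 1) := by positivity
      constructor <;> linarith [h.1, h.2]
  have hanti : Antitone fun n : ℕ => Icc (a - 1 / ((n : ℝ) + 1)) (b + 1 / ((n : ℝ) + 1)) := by
    intro m n hmn
    have : (1 : ℝ) / (n + 1) ≤ 1 / (m + 1) := Nat.one_div_le_one_div hmn
    exact Icc_subset_Icc (by linarith) (by linarith)
  have hlim := tendsto_measure_iInter_atTop (μ := σ₂)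
    (fun n : ℕ => (measurableSet_Icc (a := a - 1 / ((n : ℝ) + 1))
      (b := b + 1 / ((n : ℝ) + 1))).nullMeasurableSet) hanti
    ⟨0, isCompact_Icc.measure_lt_top.ne⟩
  rw [hInter] at hlim
  exact ge_of_tendsto' hlim hbound

instance (τ : Measure ℝ) [IsFiniteMeasure τ] : IsLocallyFiniteMeasure (tilted τ) :=
  IsLocallyFiniteMeasure.withDensity_ofReal (by fun_prop)

instance (τ : Measure ℝ) [SFinite τ] : SFinite (tilted τ) := by
  unfold tilted; infer_instance

instance (τ : Measure ℝ) (c : ℝ) [SFinite τ] : SFinite (dilation c τ) := by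
  unfold dilation; infer_instance

lemma dilation_closedBall (σ : Measure ℝ) {c : ℝ} (hc : 0 < c) (x r : ℝ) :
    dilation c σ (Metric.closedBall x r) = σ (Metric.closedBall (x / c) (r / c)) := by
  rw [dilation, Measure.map_apply (by fun_prop) measurableSet_closedBall]
  congr 1
  ext t
  simp only [mem_preimage, Metric.mem_closedBall, Real.dist_eq]
  rw [le_div_iff₀ hc, ← abs_of_pos hc, ← abs_mul, abs_of_pos hc, sub_mul, div_mul_cancel₀ _ hc.ne',
    mul_comm t]

/-- This is c² D_c(σ) ≤ σ on closed balls, the whole content of selfdecomposability used below. -/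
lemma IsBooleanSelfdecomposable.measure_closedBall_le {μ τ : Measure ℝ} {b : ℝ}
    (hμ : IsBooleanSelfdecomposable μ) (h : IsBooleanGeneratingPair μ b τ) {c : ℝ} (hc : 0 < c)
    (hc1 : c < 1) (x : ℝ) {r : ℝ} (hr : 0 ≤ r) :
    ENNReal.ofReal (c ^ 2) * tilted τ (Metric.closedBall (x / c) (r / c)) ≤
      tilted τ (Metric.closedBall x r) := by
  have := h.1
  have key := measure_Icc_le_of_poissonTransform_le
    (σ₁ := ENNReal.ofReal (c ^ 2) • dilation c (tilted τ)) (σ₂ := tilted τ)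
    (poissonTransform_tilted_ne_top h (by simp))
    (fun z hz => hμ.poissonTransform_le h hc hc1 hz) (by linarith : x - r ≤ x + r)
  rw [← Real.closedBall_eq_Icc, Measure.smul_apply, dilation_closedBall _ hc] at key
  exact key

/-! ### Differentiation of measures along balls -/

lemma volume_closedBall_pos {x r : ℝ} (hr : 0 < r) : volume (closedBall x r) ≠ 0 := by
  rw [Real.volume_closedBall]; simpa using hr

/-- If a measure is frequently bounded by `C` times Lebesgue measure on small balls around each
point of `S`, then `ρ S ≤ C · vol S`. -/
lemma measure_le_mul_volume_of_frequently_le (ρ : Measure ℝ) [SFinite ρ] {C : ℝ≥0∞} (hC : C ≠ ∞)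
    {S : Set ℝ} (h : ∀ x ∈ S, ∃ᶠ r in 𝓝[>] (0 : ℝ),
      ρ (closedBall x r) ≤ C * volume (closedBall x r)) :
    ρ S ≤ C * volume S := by
  lift C to NNReal using hC
  exact (Besicovitch.vitaliFamily ρ).measure_le_of_frequently_le (C • volume)
    Measure.AbsolutelyContinuous.rfl S
    fun x hx => (Besicovitch.tendsto_filterAt ρ x).frequently (h x hx)

lemma measure_eq_zero_of_volume_eq_zero_of_frequently_le (ρ : Measure ℝ) [SFinite ρ] {S : Set ℝ}
    (hS : volume S = 0) (h : ∀ x ∈ S, ∃ C : ℝ≥0∞, C ≠ ∞ ∧ ∃ᶠ r in 𝓝[>] (0 : ℝ),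
      ρ (closedBall x r) ≤ C * volume (closedBall x r)) :
    ρ S = 0 := by
  -- The constant may vary with the point; on each `T n` the single constant n serves.
  set T : ℕ → Set ℝ := fun n => {x ∈ S | ∃ᶠ r in 𝓝[>] (0 : ℝ),
      ρ (closedBall x r) ≤ n * volume (closedBall x r)} with hT
  have hcover : S ⊆ ⋃ n, T n := by
    intro x hx
    obtain ⟨C, hC, hf⟩ := h x hx
    obtain ⟨n, hn⟩ := ENNReal.exists_nat_gt hC
    exact mem_iUnion.2 ⟨n, hx, hf.mono fun r hr => hr.trans (by gcongr)⟩
  refine measure_mono_null hcover (measure_iUnion_null fun n => ?_)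
  have h1 := measure_le_mul_volume_of_frequently_le ρ (ENNReal.natCast_ne_top n)
    (S := T n) fun x hx => hx.2
  rw [measure_mono_null (fun x hx => hx.1) hS, mul_zero] at h1
  exact le_antisymm h1 zero_le

/-- On a bounded piece the volume is finite, so ε times it tends to 0 with ε. -/
lemma measure_eq_zero_of_forall_frequently_le (ρ : Measure ℝ) [SFinite ρ] {S : Set ℝ}
    (h : ∀ x ∈ S, ∀ ε : ℝ≥0∞, 0 < ε → ∃ᶠ r in 𝓝[>] (0 : ℝ),
      ρ (closedBall x r) ≤ ε * volume (closedBall x r)) :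
    ρ S = 0 := by
  have hcover : S ⊆ ⋃ n : ℕ, S ∩ ball 0 n := by
    rw [← inter_iUnion, iUnion_ball_nat, inter_univ]
  refine measure_mono_null hcover (measure_iUnion_null fun n => ?_)
  have hfin : volume (S ∩ ball (0 : ℝ) n) ≠ ∞ :=
    ne_top_of_le_ne_top measure_ball_lt_top.ne (measure_mono inter_subset_right)
  have hle : ∀ k : ℕ, ρ (S ∩ ball 0 n) ≤ ((k : ℝ≥0∞) + 1)⁻¹ * volume (S ∩ ball (0 : ℝ) n) :=
    fun k => measure_le_mul_volume_of_frequently_le ρ (by simp) fun x hx => h x hx.1 _ (by simp)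
  have hlim : Tendsto (fun k : ℕ => ((k : ℝ≥0∞) + 1)⁻¹ * volume (S ∩ ball (0 : ℝ) n)) atTop
      (𝓝 (0 * volume (S ∩ ball (0 : ℝ) n))) := by
    refine ENNReal.Tendsto.mul_const ?_ (Or.inr hfin)
    have := ENNReal.tendsto_inv_nat_nhds_zero.comp (tendsto_add_atTop_nat 1)
    simpa [Function.comp_def] using this
  rw [zero_mul] at hlim
  exact le_antisymm (ge_of_tendsto' hlim hle) zero_le

/-- The upper derivative of a measure with respect to Lebesgue measure along centred balls. -/
def upperDensity (σ : Measure ℝ) (x : ℝ) : ℝ≥0∞ :=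
  limsup (fun r : ℝ => σ (closedBall x r) / volume (closedBall x r)) (𝓝[>] 0)

lemma upperDensity_ae_eq (σ : Measure ℝ) [IsLocallyFiniteMeasure σ] :
    upperDensity σ =ᵐ[volume] σ.rnDeriv volume := by
  filter_upwards [Besicovitch.ae_tendsto_rnDeriv σ volume] with x hx
  exact hx.limsup_eq

lemma eventually_measure_le_of_upperDensity_lt {σ : Measure ℝ} {x : ℝ} {C : ℝ≥0∞}
    (h : upperDensity σ x < C) :
    ∀ᶠ r in 𝓝[>] (0 : ℝ), σ (closedBall x r) ≤ C * volume (closedBall x r) := by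
  filter_upwards [eventually_lt_of_limsup_lt h, self_mem_nhdsWithin] with r hr hr0
  exact (ENNReal.div_le_iff (volume_closedBall_pos hr0) measure_closedBall_lt_top.ne).1 hr.le

lemma map_div_nhdsGT_zero {c : ℝ} (hc : 0 < c) :
    map (fun r : ℝ => r / c) (𝓝[>] 0) = 𝓝[>] 0 := by
  have h : ∀ c : ℝ, 0 < c → Tendsto (fun r : ℝ => r / c) (𝓝[>] 0) (𝓝[>] 0) := by
    intro c hc
    refine tendsto_nhdsWithin_iff.2 ⟨?_, ?_⟩
    · have : Tendsto (fun r : ℝ => r / c) (𝓝 0) (𝓝 (0 / c)) := tendsto_id.div_const c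
      rw [zero_div] at this
      exact this.mono_left nhdsWithin_le_nhds
    · filter_upwards [self_mem_nhdsWithin] with r hr
      exact div_pos hr hc
  refine le_antisymm (h c hc) ?_
  have h1 := map_mono (m := fun r : ℝ => r / c) (h c⁻¹ (inv_pos.2 hc))
  rw [Filter.map_map] at h1
  have : ((fun r : ℝ => r / c) ∘ fun r => r / c⁻¹) = id := by
    ext r; simp [hc.ne']
  rwa [this, Filter.map_id] at h1

/-! ### Monotonicity of the density under selfdecomposability -/

section Selfdecomposable

variable {μ τ : Measure ℝ} {b : ℝ}

/-- Dividing the ball inequality by lengths costs one of the two factors c. The upper density is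
defined everywhere, so there is no exceptional null set depending on c. -/
lemma IsBooleanSelfdecomposable.upperDensity_le (hμ : IsBooleanSelfdecomposable μ)
    (h : IsBooleanGeneratingPair μ b τ) {c : ℝ} (hc : 0 < c) (hc1 : c < 1) (x : ℝ) :
    ENNReal.ofReal c * upperDensity (tilted τ) (x / c) ≤ upperDensity (tilted τ) x := by
  have hc0 : ENNReal.ofReal c ≠ 0 := by simpa using hc
  have hD : upperDensity (tilted τ) (x / c) = limsup (fun r : ℝ =>
      tilted τ (closedBall (x / c) (r / c)) / volume (closedBall (x / c) (r / c))) (𝓝[>] 0) := by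
    conv_lhs => rw [upperDensity, ← map_div_nhdsGT_zero hc]
    rfl
  rw [hD, ← ENNReal.limsup_const_mul_of_ne_top ENNReal.ofReal_ne_top]
  refine limsup_le_limsup ?_
  filter_upwards [self_mem_nhdsWithin] with r hr
  have hr' : (0 : ℝ) < r := hr
  have h1 := hμ.measure_closedBall_le h hc hc1 x hr'.le
  have hv : volume (closedBall x r) = ENNReal.ofReal c * volume (closedBall (x / c) (r / c)) := by
    rw [Real.volume_closedBall, Real.volume_closedBall, ← ENNReal.ofReal_mul hc.le]
    congr 1; field_simp
  calc ENNReal.ofReal c * (tilted τ (closedBall (x / c) (r / c)) /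
        volume (closedBall (x / c) (r / c)))
      = (ENNReal.ofReal c * (ENNReal.ofReal c * tilted τ (closedBall (x / c) (r / c)))) /
          (ENNReal.ofReal c * volume (closedBall (x / c) (r / c))) := by
        rw [ENNReal.mul_div_mul_left _ _ hc0 ENNReal.ofReal_ne_top, mul_div_assoc]
    _ ≤ _ := by
        rw [← hv, ← mul_assoc, ← ENNReal.ofReal_mul hc.le, ← sq]
        exact ENNReal.div_le_div_right h1 _

lemma exists_mem_Ioo_of_ae {p : ℝ → Prop} (h : ∀ᵐ x, p x) {a b : ℝ} (hab : a < b) :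
    ∃ x ∈ Ioo a b, p x := by
  have h1 : volume (Ioo a b) ≠ 0 := by simpa using hab
  by_contra! hcon
  exact h1 (measure_mono_null hcon h)

/-- An infinite value at x would propagate to c x for all c in (0, 1), an interval, while the upper
density is finite almost everywhere. -/
lemma IsBooleanSelfdecomposable.upperDensity_ne_top (hμ : IsBooleanSelfdecomposable μ)
    (h : IsBooleanGeneratingPair μ b τ) {x : ℝ} (hx : x ≠ 0) :
    upperDensity (tilted τ) x ≠ ∞ := by
  have := h.1
  have hae : ∀ᵐ t, upperDensity (tilted τ) t ≠ ∞ := by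
    filter_upwards [upperDensity_ae_eq (tilted τ), (tilted τ).rnDeriv_lt_top volume] with t h1 h2
    rw [h1]; exact h2.ne
  have key : ∀ t c : ℝ, 0 < c → c < 1 → t = c * x → upperDensity (tilted τ) t ≠ ∞ →
      upperDensity (tilted τ) x ≠ ∞ := by
    rintro t c hc hc1 rfl ht hx'
    have := hμ.upperDensity_le h hc hc1 (c * x)
    rw [mul_div_cancel_left₀ _ hc.ne', hx', ENNReal.mul_top (by simpa using hc)] at this
    exact ht (top_le_iff.1 this)
  rcases lt_or_gt_of_ne hx with hx0 | hx0
  · obtain ⟨t, ht, hp⟩ := exists_mem_Ioo_of_ae hae hx0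
    exact key t (t / x) (div_pos_of_neg_of_neg ht.2 hx0) ((div_lt_one_of_neg hx0).2 ht.1)
      (by field_simp) hp
  · obtain ⟨t, ht, hp⟩ := exists_mem_Ioo_of_ae hae hx0
    exact key t (t / x) (div_pos ht.1 hx0) ((div_lt_one hx0).2 ht.2) (by field_simp) hp

/-- The scaling inequality with c = x/y: the hypotheses put x on the same side of 0 as y and no
farther from it. -/
lemma IsBooleanSelfdecomposable.upperDensity_toReal_div_le (hμ : IsBooleanSelfdecomposable μ)
    (h : IsBooleanGeneratingPair μ b τ) {x y : ℝ} (hx : x ≠ 0) (hxy : 0 < x / y)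
    (hxy1 : x / y ≤ 1) :
    (upperDensity (tilted τ) y).toReal / |y| ≤ (upperDensity (tilted τ) x).toReal / |x| := by
  have hy : y ≠ 0 := by rintro rfl; simp at hxy
  rcases hxy1.eq_or_lt with he | hlt
  · rw [(div_eq_one_iff_eq hy).1 he]
  have h1 := hμ.upperDensity_le h hxy hlt x
  rw [div_div_cancel₀ hx] at h1
  have h2 := ENNReal.toReal_mono (hμ.upperDensity_ne_top h hx) h1
  rw [ENNReal.toReal_mul, ENNReal.toReal_ofReal hxy.le, ← abs_of_pos hxy, abs_div] at h2
  have hx' := abs_pos.2 hx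
  have hy' := abs_pos.2 hy
  rw [div_le_div_iff₀ hy' hx']
  rw [div_mul_eq_mul_div, div_le_iff₀ hy'] at h2
  linarith

/-- Finite upper density dominates σ by Lebesgue measure on small balls, which rules out a singular
part off 0. -/
lemma IsBooleanSelfdecomposable.tilted_eq_zero_of_volume_eq_zero
    (hμ : IsBooleanSelfdecomposable μ) (h : IsBooleanGeneratingPair μ b τ) {S : Set ℝ}
    (hS : volume S = 0) (h0 : (0 : ℝ) ∉ S) : tilted τ S = 0 := by
  have := h.1
  refine measure_eq_zero_of_volume_eq_zero_of_frequently_le _ hS fun x hx => ?_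
  have hx0 : x ≠ 0 := fun h => h0 (h ▸ hx)
  have hlt := hμ.upperDensity_ne_top h hx0
  refine ⟨upperDensity (tilted τ) x + 1, by simpa using hlt, ?_⟩
  exact (eventually_measure_le_of_upperDensity_lt (ENNReal.lt_add_right hlt one_ne_zero)).frequently

end Selfdecomposable

/-- The Boolean Lévy measure in terms of `(1 + x²) τ(dx)`. -/
lemma levy_eq_withDensity_tilted (τ : Measure ℝ) :
    (τ.restrict {0}ᶜ).withDensity (fun x => ENNReal.ofReal ((1 + x ^ 2) / x ^ 2)) =
      ((tilted τ).restrict {0}ᶜ).withDensity (fun x => ENNReal.ofReal (1 / x ^ 2)) := by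
  rw [tilted, restrict_withDensity (by simp), ← withDensity_mul _ (by fun_prop) (by fun_prop)]
  congr 1; ext x
  rw [Pi.mul_apply, ← ENNReal.ofReal_mul (by positivity), mul_one_div]

/-- The Lévy measure is x⁻² σ off 0, and |x| · x⁻² = 1/|x|; so k is the density of σ divided by |x|.
-/
lemma rnDeriv_levy_ae_eq (τ : Measure ℝ) [IsFiniteMeasure τ] :
    (fun x => |x| * (((τ.restrict {0}ᶜ).withDensity
      (fun x => ENNReal.ofReal ((1 + x ^ 2) / x ^ 2))).rnDeriv volume x).toReal) =ᵐ[volume]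
      fun x => ((tilted τ).rnDeriv volume x).toReal / |x| := by
  rw [levy_eq_withDensity_tilted]
  have h0 : ∀ᵐ x : ℝ, x ≠ 0 := by simp [ae_iff]
  filter_upwards [Measure.rnDeriv_withDensity_left (μ := (tilted τ).restrict {0}ᶜ) (ν := volume)
      (f := fun x => ENNReal.ofReal (1 / x ^ 2)) (by fun_prop) (by simp),
    Measure.rnDeriv_restrict (tilted τ) volume (s := {0}ᶜ) (by simp), h0] with x h1 h2 hx
  rw [h1, h2, indicator_of_mem (by simpa using hx), ENNReal.toReal_mul,
    ENNReal.toReal_ofReal (by positivity), ← sq_abs]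
  have := abs_pos.2 hx
  field_simp

/-! ### Where σ is large, μ is small -/

/-- On the ball of radius y about u the Poisson kernel at u + iy is at least 1/(2y), the reciprocal
of the length. -/
lemma measure_closedBall_le_poissonTransform_mul (ρ : Measure ℝ) (u : ℝ) {y : ℝ} (hy : 0 < y) :
    ρ (closedBall u y) ≤ poissonTransform ρ ⟨u, y⟩ * volume (closedBall u y) := by
  have h2 : (0 : ℝ) < 2 * y := by positivity
  rw [Real.volume_closedBall, ← ENNReal.div_le_iff (by simpa using hy) ENNReal.ofReal_ne_top,
    div_eq_mul_inv, ← ENNReal.ofReal_inv_of_pos h2, mul_comm]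
  calc ENNReal.ofReal (2 * y)⁻¹ * ρ (closedBall u y)
      = ∫⁻ x in closedBall u y, ENNReal.ofReal (2 * y)⁻¹ ∂ρ := by rw [setLIntegral_const]
    _ ≤ ∫⁻ x in closedBall u y, ENNReal.ofReal (y / Complex.normSq (⟨u, y⟩ - (x : ℂ))) ∂ρ := by
        refine setLIntegral_mono' measurableSet_closedBall fun x hx => ENNReal.ofReal_le_ofReal ?_
        rw [normSq_sub_ofReal]
        have hx' : |u - x| ≤ y := by rwa [mem_closedBall, dist_comm, Real.dist_eq] at hx
        have h3 : (u - x) ^ 2 ≤ y ^ 2 := by rw [← sq_abs]; gcongr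
        rw [inv_eq_one_div, div_le_div_iff₀ h2 (by positivity)]
        nlinarith
    _ ≤ _ := setLIntegral_le_lintegral _ _

lemma measure_singleton_le_mul_poissonTransform (ρ : Measure ℝ) (u : ℝ) {y : ℝ} (hy : 0 < y) :
    ρ {u} ≤ ENNReal.ofReal y * poissonTransform ρ ⟨u, y⟩ := by
  calc ρ {u} = ENNReal.ofReal y * ∫⁻ x in {u},
        ENNReal.ofReal (y / Complex.normSq (⟨u, y⟩ - (x : ℂ))) ∂ρ := by
        rw [lintegral_singleton, normSq_sub_ofReal, ← mul_assoc, ← ENNReal.ofReal_mul hy.le]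
        simp only [sub_self]
        have : y * (y / (0 ^ 2 + y ^ 2)) = 1 := by field_simp; simp
        rw [this, ENNReal.ofReal_one, one_mul]
    _ ≤ _ := by gcongr; exact setLIntegral_le_lintegral _ _

section GeneratingPair

variable {μ τ : Measure ℝ} {b : ℝ}

/-- By P_μ P_σ ≤ 1: an average of σ of at least m over the ball would force P_σ ≥ m, hence P_μ ≤
1/m, at u + iy. -/
lemma measure_closedBall_le_of_le_tilted [IsProbabilityMeasure μ]
    (h : IsBooleanGeneratingPair μ b τ) {m : ℝ≥0∞}
    (u : ℝ) {y : ℝ} (hy : 0 < y)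
    (hle : m * volume (closedBall u y) ≤ tilted τ (closedBall u y)) :
    μ (closedBall u y) ≤ m⁻¹ * volume (closedBall u y) := by
  have h1 := hle.trans (measure_closedBall_le_poissonTransform_mul (tilted τ) u hy)
  rw [ENNReal.mul_le_mul_iff_left (volume_closedBall_pos hy) measure_closedBall_lt_top.ne] at h1
  have h2 := poissonTransform_mul_le_one h (z := ⟨u, y⟩) hy
  refine (measure_closedBall_le_poissonTransform_mul μ u hy).trans ?_
  gcongr
  rw [ENNReal.le_inv_iff_mul_le]
  exact (by gcongr : _ ≤ _).trans h2

/-- An atom `p` of `μ` satisfies `μ {p} ∫ (x - p)⁻² (1 + x²) τ(dx) ≤ 1`. -/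
lemma measure_singleton_mul_lintegral_le_one [IsProbabilityMeasure μ]
    (h : IsBooleanGeneratingPair μ b τ) (p : ℝ) :
    μ {p} * ∫⁻ x, (ENNReal.ofReal ((p - x) ^ 2))⁻¹ ∂(tilted τ) ≤ 1 := by
  set y : ℕ → ℝ := fun n => 1 / ((n : ℝ) + 1) with hy
  have hy0 : ∀ n, 0 < y n := fun n => by positivity
  have hylim : Tendsto y atTop (𝓝 0) := tendsto_one_div_add_atTop_nhds_zero_nat
  have hn : ∀ n, μ {p} * ∫⁻ x, (ENNReal.ofReal ((p - x) ^ 2 + y n ^ 2))⁻¹ ∂(tilted τ) ≤ 1 := by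
    intro n
    have hz : 0 < (⟨p, y n⟩ : ℂ).im := hy0 n
    have h1 : poissonTransform (tilted τ) ⟨p, y n⟩ = ENNReal.ofReal (y n) *
        ∫⁻ x, (ENNReal.ofReal ((p - x) ^ 2 + y n ^ 2))⁻¹ ∂(tilted τ) := by
      rw [poissonTransform, ← lintegral_const_mul' _ _ ENNReal.ofReal_ne_top]
      congr 1; ext x
      have : 0 < (p - x) ^ 2 + y n ^ 2 := by have := hy0 n; positivity
      rw [normSq_sub_ofReal, ← ENNReal.ofReal_inv_of_pos this, ← ENNReal.ofReal_mul (hy0 n).le,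
        div_eq_mul_inv]
    -- The factor y in μ{p} ≤ y P_μ is the one needed to complete the integral to P_σ.
    calc _ ≤ (ENNReal.ofReal (y n) * poissonTransform μ ⟨p, y n⟩) *
          ∫⁻ x, (ENNReal.ofReal ((p - x) ^ 2 + y n ^ 2))⁻¹ ∂(tilted τ) := by
          gcongr; exact measure_singleton_le_mul_poissonTransform μ p (hy0 n)
      _ = poissonTransform μ ⟨p, y n⟩ * poissonTransform (tilted τ) ⟨p, y n⟩ := by
          rw [h1]; ring
      _ ≤ 1 := poissonTransform_mul_le_one h hz
  rcases eq_or_ne (μ {p}) 0 with h0 | h0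
  · simp [h0]
  have hpt : ∀ x : ℝ, liminf (fun n => (ENNReal.ofReal ((p - x) ^ 2 + y n ^ 2))⁻¹) atTop =
      (ENNReal.ofReal ((p - x) ^ 2))⁻¹ := by
    intro x
    refine Tendsto.liminf_eq ?_
    refine (ENNReal.tendsto_ofReal ?_).inv
    simpa using (tendsto_const_nhds (x := (p - x) ^ 2)).add (hylim.pow 2)
  -- Fatou as y → 0. The integrand at x = p is 0⁻¹ = ∞ in `ℝ≥0∞`, so an atom of σ at p is accounted
  -- for.
  have hfatou := lintegral_liminf_le (μ := tilted τ) (u := atTop)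
    (f := fun n x => (ENNReal.ofReal ((p - x) ^ 2 + y n ^ 2))⁻¹) fun n => by fun_prop
  simp only [hpt] at hfatou
  rw [mul_comm, ← ENNReal.le_inv_iff_mul_le]
  refine hfatou.trans (liminf_le_of_le (by isBoundedDefault) fun c hc => ?_)
  obtain ⟨n, hn'⟩ := hc.exists
  refine hn'.trans ?_
  rw [ENNReal.le_inv_iff_mul_le, mul_comm]
  exact hn n

variable {k : ℝ → ℝ}

lemma rnDeriv_tilted_ae_eq (h : IsBooleanGeneratingPair μ b τ)
    (hk : k =ᵐ[volume] fun x => ((tilted τ).rnDeriv volume x).toReal / |x|) :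
    (tilted τ).rnDeriv volume =ᵐ[volume] fun x => ENNReal.ofReal (|x| * k x) := by
  have := h.1
  have h0 : ∀ᵐ x : ℝ, x ≠ 0 := by simp [ae_iff]
  filter_upwards [hk, (tilted τ).rnDeriv_lt_top volume, h0] with x h1 h2 h3
  have := abs_pos.2 h3
  rw [h1, mul_div_cancel₀ _ this.ne', ENNReal.ofReal_toReal h2.ne]

/-- Only the absolutely continuous part of σ, with density |x| k(x), is used; a singular part would
only help. -/
lemma mul_volume_le_tilted (h : IsBooleanGeneratingPair μ b τ)
    (hk : k =ᵐ[volume] fun x => ((tilted τ).rnDeriv volume x).toReal / |x|) {S : Set ℝ}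
    (hS : MeasurableSet S) {m : ℝ} (hm : ∀ x ∈ S, m ≤ |x| * k x) :
    ENNReal.ofReal m * volume S ≤ tilted τ S := by
  refine le_trans ?_ (Measure.setLIntegral_rnDeriv_le (ν := volume) S)
  rw [lintegral_congr_ae (ae_restrict_of_ae (rnDeriv_tilted_ae_eq h hk)), ← setLIntegral_const]
  exact setLIntegral_mono' hS fun x hx => ENNReal.ofReal_le_ofReal (hm x hx)

/-- Near a point `u ≠ 0` that is strictly dominated by a point `w` with `k w > 0`, the measure
`μ` is bounded by a multiple of Lebesgue measure on small balls. -/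
lemma exists_eventually_measure_closedBall_le [IsProbabilityMeasure μ]
    (h : IsBooleanGeneratingPair μ b τ)
    (hk : k =ᵐ[volume] fun x => ((tilted τ).rnDeriv volume x).toReal / |x|) {u w : ℝ}
    (hw : 0 < k w) {r : ℝ} (hr : 0 < r) (hu : u ≠ 0)
    (hle : ∀ x ∈ closedBall u r, x ≠ 0 → k w ≤ k x) :
    ∃ C : ℝ≥0∞, C ≠ ∞ ∧ ∀ᶠ y in 𝓝[>] (0 : ℝ),
      μ (closedBall u y) ≤ C * volume (closedBall u y) := by
  have hu' := abs_pos.2 hu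
  have hm : 0 < |u| / 2 * k w := by positivity
  refine ⟨(ENNReal.ofReal (|u| / 2 * k w))⁻¹, ENNReal.inv_ne_top.2 (by simpa using hm), ?_⟩
  -- Radii up to |u|/2 keep |x| ≥ |u|/2 on the ball, so |x| k(x) ≥ (|u|/2) k(w).
  filter_upwards [Ioc_mem_nhdsGT (lt_min hr (half_pos hu'))] with y hy
  have hy1 := hy.2.trans (min_le_left _ _)
  have hy2 := hy.2.trans (min_le_right _ _)
  refine measure_closedBall_le_of_le_tilted h u hy.1
    (mul_volume_le_tilted h hk measurableSet_closedBall fun x hx => ?_)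
  have hx1 : |u| / 2 ≤ |x| := by
    have h1 : |u - x| ≤ y := by rwa [mem_closedBall, dist_comm, Real.dist_eq] at hx
    have := abs_sub_abs_le_abs_sub u x
    linarith
  have hx0 : x ≠ 0 := abs_pos.1 (by linarith)
  have := hle x (closedBall_subset_closedBall hy1 hx) hx0
  gcongr

lemma lintegral_uIoc_inv_abs {w : ℝ} (hw : w ≠ 0) :
    ∫⁻ x in uIoc 0 w, ENNReal.ofReal |x|⁻¹ = ∞ := by
  have h1 : ¬ IntervalIntegrable (fun x : ℝ => x⁻¹) volume 0 w := by
    rw [intervalIntegrable_inv_iff]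
    push Not
    exact ⟨hw.symm, left_mem_uIcc⟩
  rw [intervalIntegrable_iff] at h1
  by_contra hfin
  refine h1 ⟨measurable_inv.aestronglyMeasurable, ?_⟩
  rw [HasFiniteIntegral]
  refine lt_of_eq_of_lt (lintegral_congr fun x => ?_) (lt_top_iff_ne_top.2 hfin)
  rw [← abs_inv, Real.enorm_eq_ofReal_abs]

/-- Between 0 and w the integrand is at least |x| k(w) / x² = k(w)/|x|, which is not integrable at
0. -/
lemma lintegral_tilted_inv_sq_eq_top (h : IsBooleanGeneratingPair μ b τ)
    (hk : k =ᵐ[volume] fun x => ((tilted τ).rnDeriv volume x).toReal / |x|) {w : ℝ}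
    (hw0 : w ≠ 0) (hw : 0 < k w) (hle : ∀ x ∈ uIoc 0 w, x ≠ 0 → k w ≤ k x) :
    ∫⁻ x, (ENNReal.ofReal ((0 - x) ^ 2))⁻¹ ∂(tilted τ) = ∞ := by
  have := h.1
  rw [← top_le_iff]
  calc (∞ : ℝ≥0∞) = ∫⁻ x in uIoc 0 w, ENNReal.ofReal (k w) * ENNReal.ofReal |x|⁻¹ := by
        rw [lintegral_const_mul' _ _ ENNReal.ofReal_ne_top, lintegral_uIoc_inv_abs hw0,
          ENNReal.mul_top (by simpa using hw)]
    _ ≤ ∫⁻ x in uIoc 0 w, ENNReal.ofReal (|x| * k x) * (ENNReal.ofReal ((0 - x) ^ 2))⁻¹ := by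
        refine setLIntegral_mono' measurableSet_uIoc fun x hx => ?_
        rcases eq_or_ne x 0 with rfl | hx0
        · simp
        have hx' := abs_pos.2 hx0
        have hkx := hle x hx hx0
        rw [zero_sub, neg_sq, ← ENNReal.ofReal_inv_of_pos (by positivity),
          ← ENNReal.ofReal_mul hw.le, ← ENNReal.ofReal_mul (by nlinarith)]
        refine ENNReal.ofReal_le_ofReal ?_
        rw [← sq_abs x]
        calc k w * |x|⁻¹ ≤ k x * |x|⁻¹ := by gcongr
          _ = |x| * k x * (|x| ^ 2)⁻¹ := by field_simp
    _ ≤ ∫⁻ x, ENNReal.ofReal (|x| * k x) * (ENNReal.ofReal ((0 - x) ^ 2))⁻¹ :=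
        setLIntegral_le_lintegral _ _
    _ = ∫⁻ x, (tilted τ).rnDeriv volume x * (ENNReal.ofReal ((0 - x) ^ 2))⁻¹ := by
        refine lintegral_congr_ae ?_
        filter_upwards [rnDeriv_tilted_ae_eq h hk] with x hx
        rw [hx]
    _ = ∫⁻ x, (ENNReal.ofReal ((0 - x) ^ 2))⁻¹
          ∂(volume.withDensity ((tilted τ).rnDeriv volume)) := by
        rw [lintegral_withDensity_eq_lintegral_mul _ (Measure.measurable_rnDeriv _ _)
          (by fun_prop)]
        rfl
    _ ≤ _ := lintegral_mono' (Measure.withDensity_rnDeriv_le _ _) le_rfl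

end GeneratingPair

/-! ### Boundary values of F off the mass of τ -/

/-- The boundary value `p - b - ∫ (1 + x p) / (p - x) τ(dx)` of the `F`-transform at `p ∈ ℝ`. -/
def boundaryF (b : ℝ) (τ : Measure ℝ) (p : ℝ) : ℝ :=
  p - b - ∫ x, (1 + x * p) / (p - x) ∂τ

/-- The integral `∫ (p - x)⁻² (1 + x²) τ(dx)`. -/
def inverseSquareIntegral (τ : Measure ℝ) (p : ℝ) : ℝ≥0∞ :=
  ∫⁻ x, (ENNReal.ofReal ((p - x) ^ 2))⁻¹ ∂(tilted τ)

lemma inverseSquareIntegral_eq (τ : Measure ℝ) (p : ℝ) :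
    inverseSquareIntegral τ p =
      ∫⁻ x, ENNReal.ofReal (1 + x ^ 2) * (ENNReal.ofReal ((p - x) ^ 2))⁻¹ ∂τ := by
  have hm : Measurable fun x : ℝ => (ENNReal.ofReal ((p - x) ^ 2))⁻¹ := by fun_prop
  rw [inverseSquareIntegral, lintegral_tilted τ hm]

section

variable {τ : Measure ℝ} {p q : ℝ}

/-- The value 0⁻¹ = ∞ in `ℝ≥0∞` makes the integral infinite if τ charges p. -/
lemma ae_ne_of_inverseSquareIntegral_ne_top (hp : inverseSquareIntegral τ p ≠ ∞) :
    ∀ᵐ x ∂τ, x ≠ p := by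
  rw [inverseSquareIntegral_eq] at hp
  filter_upwards [ae_lt_top (by fun_prop) hp] with x hx hxp
  subst hxp
  have : (0 : ℝ) < 1 + x ^ 2 := by positivity
  simp [ENNReal.mul_top, this] at hx

lemma integrable_of_inverseSquareIntegral_ne_top (hp : inverseSquareIntegral τ p ≠ ∞) :
    Integrable (fun x => (1 + x ^ 2) / (p - x) ^ 2) τ := by
  refine ⟨Measurable.aestronglyMeasurable (by fun_prop), ?_⟩
  rw [hasFiniteIntegral_iff_ofReal (ae_of_all _ fun x => by positivity)]
  refine lt_of_le_of_lt ?_ (lt_top_iff_ne_top.2 hp)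
  rw [inverseSquareIntegral_eq]
  refine lintegral_mono_ae ?_
  filter_upwards [ae_ne_of_inverseSquareIntegral_ne_top hp] with x hx
  have : 0 < (p - x) ^ 2 := by have := sub_ne_zero.2 hx.symm; positivity
  rw [← ENNReal.ofReal_inv_of_pos this, ← ENNReal.ofReal_mul (by positivity), div_eq_mul_inv]

lemma inverseSquareIntegral_ne_top [IsFiniteMeasure τ] {δ : ℝ} (hδ : 0 < δ)
    (h : ∀ᵐ x ∂τ, δ ≤ |p - x|) : inverseSquareIntegral τ p ≠ ∞ := by
  rw [inverseSquareIntegral_eq]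
  have hle : ∫⁻ x, ENNReal.ofReal (1 + x ^ 2) * (ENNReal.ofReal ((p - x) ^ 2))⁻¹ ∂τ ≤
      ∫⁻ _, ENNReal.ofReal ((1 + 2 * p ^ 2) / δ ^ 2 + 2) ∂τ := by
    refine lintegral_mono_ae ?_
    filter_upwards [h] with x hx
    have h1 : δ ^ 2 ≤ (p - x) ^ 2 := by rw [← sq_abs (p - x)]; gcongr
    have h2 : 0 < (p - x) ^ 2 := lt_of_lt_of_le (by positivity) h1
    rw [← ENNReal.ofReal_inv_of_pos h2, ← ENNReal.ofReal_mul (by positivity)]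
    refine ENNReal.ofReal_le_ofReal ?_
    -- From x² ≤ 2p² + 2(p - x)², the difference being (2p - x)².
    rw [← div_eq_mul_inv, div_le_iff₀ h2, add_mul]
    have h3 : 1 + 2 * p ^ 2 ≤ (1 + 2 * p ^ 2) / δ ^ 2 * (p - x) ^ 2 := by
      rw [div_mul_eq_mul_div, le_div_iff₀ (by positivity)]
      gcongr
    nlinarith [sq_nonneg (2 * p - x)]
  refine ne_top_of_le_ne_top ?_ hle
  rw [lintegral_const]
  exact ENNReal.mul_ne_top ENNReal.ofReal_ne_top (measure_ne_top _ _)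

/-- A majorant uniform in y ≤ 1: the bound Q ≤ 1 + Q² trades the singularity |p - x|⁻¹ for |p -
x|⁻², and Cauchy–Schwarz gives (1 + |x| M)² ≤ (1 + M²)(1 + x²). -/
lemma norm_tilted_kernel_le {y : ℝ} (hy : 0 < y) (hy1 : y ≤ 1) {x : ℝ} (hx : x ≠ p) :
    ‖(1 + (x : ℂ) * ⟨p, y⟩) / (⟨p, y⟩ - (x : ℂ))‖ ≤
      1 + (1 + (|p| + 1) ^ 2) * ((1 + x ^ 2) / (p - x) ^ 2) := by
  have hd : 0 < |p - x| := abs_pos.2 (sub_ne_zero.2 hx.symm)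
  have h1 : |p - x| ≤ ‖(⟨p, y⟩ : ℂ) - (x : ℂ)‖ := by
    simpa using Complex.abs_re_le_norm ((⟨p, y⟩ : ℂ) - (x : ℂ))
  have h2 : ‖(⟨p, y⟩ : ℂ)‖ ≤ |p| + 1 := by
    have := Complex.norm_le_abs_re_add_abs_im (⟨p, y⟩ : ℂ)
    simp only [abs_of_pos hy] at this
    linarith
  have h3 : ‖1 + (x : ℂ) * ⟨p, y⟩‖ ≤ 1 + |x| * (|p| + 1) := by
    refine (norm_add_le _ _).trans ?_
    rw [norm_one, norm_mul, Complex.norm_real, Real.norm_eq_abs]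
    gcongr
  rw [norm_div]
  set M := |p| + 1
  have hM : 0 ≤ M := by positivity
  set Q := (1 + |x| * M) / |p - x|
  have h4 : ‖1 + (x : ℂ) * ⟨p, y⟩‖ / ‖(⟨p, y⟩ : ℂ) - (x : ℂ)‖ ≤ Q :=
    div_le_div₀ (by positivity) h3 hd h1
  have h5 : Q ≤ 1 + Q ^ 2 := by nlinarith [sq_nonneg (Q - 1)]
  have h6 : Q ^ 2 ≤ (1 + M ^ 2) * ((1 + x ^ 2) / (p - x) ^ 2) := by
    rw [div_pow, sq_abs, ← mul_div_assoc]
    gcongr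
    rw [← sq_abs x]
    nlinarith [sq_nonneg (M - |x|)]
  linarith

lemma tendsto_mk_nhdsGT_zero (p : ℝ) :
    Tendsto (fun y : ℝ => (⟨p, y⟩ : ℂ)) (𝓝[>] 0) (𝓝 (p : ℂ)) := by
  have h : Continuous fun y : ℝ => (⟨p, y⟩ : ℂ) := by
    have : (fun y : ℝ => (⟨p, y⟩ : ℂ)) = fun y : ℝ => (p : ℂ) + y * Complex.I := by
      ext y; apply Complex.ext <;> simp
    rw [this]; fun_prop
  exact (h.tendsto 0).mono_left nhdsWithin_le_nhds

lemma tendsto_integral_tilted_kernel [IsFiniteMeasure τ]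
    (hp : inverseSquareIntegral τ p ≠ ∞) :
    Tendsto (fun y : ℝ => ∫ x : ℝ, (1 + (x : ℂ) * ⟨p, y⟩) / (⟨p, y⟩ - (x : ℂ)) ∂τ) (𝓝[>] 0)
      (𝓝 ((∫ x, (1 + x * p) / (p - x) ∂τ : ℝ) : ℂ)) := by
  rw [← integral_complex_ofReal]
  refine tendsto_integral_filter_of_dominated_convergence
    (fun x => 1 + (1 + (|p| + 1) ^ 2) * ((1 + x ^ 2) / (p - x) ^ 2)) ?_ ?_ ?_ ?_
  · exact Eventually.of_forall fun y => Measurable.aestronglyMeasurable (by fun_prop)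
  · filter_upwards [Ioc_mem_nhdsGT one_pos] with y hy
    filter_upwards [ae_ne_of_inverseSquareIntegral_ne_top hp] with x hx
    exact norm_tilted_kernel_le hy.1 hy.2 hx
  · exact (integrable_const _).add
      ((integrable_of_inverseSquareIntegral_ne_top hp).const_mul _)
  · filter_upwards [ae_ne_of_inverseSquareIntegral_ne_top hp] with x hx
    have hz := tendsto_mk_nhdsGT_zero p
    push_cast
    refine Tendsto.div (tendsto_const_nhds.add (tendsto_const_nhds.mul hz))
      (hz.sub tendsto_const_nhds) ?_
    exact_mod_cast sub_ne_zero.2 hx.symm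

lemma integrable_boundary_kernel [IsFiniteMeasure τ] (hp : inverseSquareIntegral τ p ≠ ∞) :
    Integrable (fun x => (1 + x * p) / (p - x)) τ := by
  refine Integrable.mono' ((integrable_const (1 : ℝ)).add
      ((integrable_of_inverseSquareIntegral_ne_top hp).const_mul (1 + p ^ 2)))
    (Measurable.aestronglyMeasurable (by fun_prop)) (ae_of_all _ fun x => ?_)
  rw [Real.norm_eq_abs]
  set Q := (1 + x * p) / (p - x)
  have h5 : |Q| ≤ 1 + Q ^ 2 := by rw [← sq_abs]; nlinarith [sq_nonneg (|Q| - 1)]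
  have h6 : Q ^ 2 ≤ (1 + p ^ 2) * ((1 + x ^ 2) / (p - x) ^ 2) := by
    rw [div_pow, ← mul_div_assoc]
    gcongr
    nlinarith [sq_nonneg (p - x)]
  exact h5.trans (by simpa using h6)

/-- Two zeros of the boundary function, between which `τ` has no mass, coincide. -/
lemma eq_of_boundaryF_eq [IsFiniteMeasure τ] {b : ℝ} (hp : inverseSquareIntegral τ p ≠ ∞)
    (hq : inverseSquareIntegral τ q ≠ ∞) (hpq : ∀ᵐ x ∂τ, 0 ≤ (p - x) * (q - x))
    (h : boundaryF b τ p = boundaryF b τ q) : p = q := by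
  have hint := integral_sub (integrable_boundary_kernel hp) (integrable_boundary_kernel hq)
  -- Partial fractions: (1 + xp)(q - x) - (1 + xq)(p - x) = (q - p)(1 + x²).
  have hcongr : ∫ x, ((1 + x * p) / (p - x) - (1 + x * q) / (q - x)) ∂τ =
      ∫ x, (q - p) * ((1 + x ^ 2) / ((p - x) * (q - x))) ∂τ := by
    refine integral_congr_ae ?_
    filter_upwards [ae_ne_of_inverseSquareIntegral_ne_top hp,
      ae_ne_of_inverseSquareIntegral_ne_top hq] with x h1 h2
    have h1' := sub_ne_zero.2 h1.symm
    have h2' := sub_ne_zero.2 h2.symm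
    field_simp
    ring
  have hnn : 0 ≤ ∫ x, (1 + x ^ 2) / ((p - x) * (q - x)) ∂τ := by
    refine integral_nonneg_of_ae ?_
    filter_upwards [hpq] with x hx
    exact div_nonneg (by positivity) hx
  rw [hcongr, integral_const_mul] at hint
  rw [boundaryF, boundaryF] at h
  set J := ∫ x, (1 + x ^ 2) / ((p - x) * (q - x)) ∂τ
  -- The difference of boundary values is (p - q)(1 + J) with J ≥ 0: the boundary function is
  -- strictly increasing.
  have h0 : (p - q) * (1 + J) = 0 := by linarith
  rcases mul_eq_zero.1 h0 with h1 | h1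
  · linarith
  · linarith

end

section GeneratingPair

variable {μ τ : Measure ℝ} {b : ℝ}

lemma tendsto_fTransform (h : IsBooleanGeneratingPair μ b τ) {p : ℝ}
    (hp : inverseSquareIntegral τ p ≠ ∞) :
    Tendsto (fun y : ℝ => fTransform μ ⟨p, y⟩) (𝓝[>] 0) (𝓝 (boundaryF b τ p : ℂ)) := by
  have := h.1
  have h1 := ((tendsto_mk_nhdsGT_zero p).sub (tendsto_const_nhds (x := (b : ℂ)))).sub
    (tendsto_integral_tilted_kernel hp)
  rw [boundaryF]
  push_cast at h1 ⊢
  refine h1.congr' ?_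
  filter_upwards [self_mem_nhdsWithin] with y hy
  have h2 := h.2 ⟨p, y⟩ hy
  rw [selfEnergy] at h2
  linear_combination h2

/-- G = 1/F tends to the real number 1/F(p), so its imaginary part vanishes in the limit. -/
lemma tendsto_poissonTransform_zero [IsProbabilityMeasure μ]
    (h : IsBooleanGeneratingPair μ b τ) {p : ℝ}
    (hp : inverseSquareIntegral τ p ≠ ∞) (hF : boundaryF b τ p ≠ 0) :
    Tendsto (fun y : ℝ => poissonTransform μ ⟨p, y⟩) (𝓝[>] 0) (𝓝 0) := by
  have h1 := ((tendsto_fTransform h hp).inv₀ (by exact_mod_cast hF))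
  have h2 := ENNReal.tendsto_ofReal ((Complex.continuous_im.tendsto _).comp h1).neg
  rw [← Complex.ofReal_inv, Complex.ofReal_im, neg_zero, ENNReal.ofReal_zero] at h2
  refine h2.congr' ?_
  filter_upwards [self_mem_nhdsWithin] with y hy
  rw [← ofReal_neg_im_cauchyTransform μ (z := ⟨p, y⟩) hy, Function.comp_apply, fTransform,
    one_div, inv_inv]

/-- Three kinds of points of S: those with a nonzero boundary value form a μ-null set, as the ball
averages of μ tend to 0 there; an infinite integral can occur only at e, which is then no atom; the
zeros of the boundary function number at most one. -/
lemma isZeroOrPointMass_restrict [IsProbabilityMeasure μ]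
    (h : IsBooleanGeneratingPair μ b τ) {S : Set ℝ} {e : ℝ}
    (hS : ∀ p ∈ S, ∀ q ∈ S, ∀ᵐ x ∂τ, 0 ≤ (p - x) * (q - x))
    (hfin : ∀ p ∈ S, p ≠ e → inverseSquareIntegral τ p ≠ ∞) :
    IsZeroOrPointMass (μ.restrict S) := by
  have := h.1
  set Z := {p ∈ S | inverseSquareIntegral τ p ≠ ∞ ∧ boundaryF b τ p = 0} with hZ
  have hZS : Z ⊆ S := fun p hp => hp.1
  have hsub : Z.Subsingleton := fun p hp q hq =>
    eq_of_boundaryF_eq hp.2.1 hq.2.1 (hS p hp.1 q hq.1) (hp.2.2.trans hq.2.2.symm)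
  have hN : μ {p | inverseSquareIntegral τ p ≠ ∞ ∧ boundaryF b τ p ≠ 0} = 0 := by
    refine measure_eq_zero_of_forall_frequently_le μ fun p hp ε hε => Eventually.frequently ?_
    filter_upwards [(tendsto_poissonTransform_zero h hp.1 hp.2).eventually_lt_const hε,
      self_mem_nhdsWithin] with y hy hy0
    exact (measure_closedBall_le_poissonTransform_mul μ p hy0).trans (by gcongr)
  have hT : μ {p ∈ S | inverseSquareIntegral τ p = ∞} = 0 := by
    by_cases he : inverseSquareIntegral τ e = ∞
    · have h1 := measure_singleton_mul_lintegral_le_one h e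
      rw [show ∫⁻ x, (ENNReal.ofReal ((e - x) ^ 2))⁻¹ ∂(tilted τ) = ∞ from he] at h1
      refine measure_mono_null (t := {e}) (fun p hp => ?_) ?_
      · by_contra hpe
        exact hfin p hp.1 hpe hp.2
      · by_contra h0
        rw [ENNReal.mul_top h0] at h1
        simp at h1
    · refine measure_mono_null (t := ∅) (fun p hp => ?_) measure_empty
      rcases eq_or_ne p e with rfl | hpe
      · exact he hp.2
      · exact hfin p hp.1 hpe hp.2
  have hdiff : μ (S \ Z) = 0 := by
    refine measure_mono_null (fun p hp => ?_) (measure_union_null hN hT)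
    by_cases hI : inverseSquareIntegral τ p = ∞
    · exact Or.inr ⟨hp.1, hI⟩
    · exact Or.inl ⟨hI, fun h0 => hp.2 ⟨hp.1, hI, h0⟩⟩
  have hae : S =ᵐ[μ] Z := by
    rw [ae_eq_set]
    exact ⟨hdiff, by rw [sdiff_eq_empty.2 hZS, measure_empty]⟩
  rw [Measure.restrict_congr_set hae]
  rcases hsub.eq_empty_or_singleton with h0 | ⟨p, h0⟩
  · left; rw [h0, Measure.restrict_empty]
  · rw [h0, Measure.restrict_singleton]
    rcases eq_or_ne (μ {p}) 0 with hp | hp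
    · left; rw [hp, zero_smul]
    · exact Or.inr ⟨p, μ {p}, hp, rfl⟩

/-- Every p > e lies at distance p - e from the mass of τ; only e itself may have an infinite
inverse square integral. -/
lemma isZeroOrPointMass_restrict_Ici [IsProbabilityMeasure μ]
    (h : IsBooleanGeneratingPair μ b τ) {e : ℝ}
    (he : τ (Ioi e) = 0) : IsZeroOrPointMass (μ.restrict (Ici e)) := by
  have := h.1
  have hae : ∀ᵐ x ∂τ, x ≤ e := by
    rw [ae_iff]; simpa [Ioi_def] using he
  refine isZeroOrPointMass_restrict h (e := e) (fun p hp q hq => ?_) fun p hp hpe => ?_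
  · filter_upwards [hae] with x hx
    have hp : e ≤ p := hp
    have hq : e ≤ q := hq
    exact mul_nonneg (by linarith) (by linarith)
  · have hp : e < p := lt_of_le_of_ne hp hpe.symm
    refine inverseSquareIntegral_ne_top (sub_pos.2 hp) ?_
    filter_upwards [hae] with x hx
    rw [abs_of_pos (by linarith)]; linarith

lemma isZeroOrPointMass_restrict_Iic [IsProbabilityMeasure μ]
    (h : IsBooleanGeneratingPair μ b τ) {e : ℝ}
    (he : τ (Iio e) = 0) : IsZeroOrPointMass (μ.restrict (Iic e)) := by
  have := h.1
  have hae : ∀ᵐ x ∂τ, e ≤ x := by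
    rw [ae_iff]; simpa [Iio_def] using he
  refine isZeroOrPointMass_restrict h (e := e) (fun p hp q hq => ?_) fun p hp hpe => ?_
  · filter_upwards [hae] with x hx
    have hp : p ≤ e := hp
    have hq : q ≤ e := hq
    exact mul_nonneg_of_nonpos_of_nonpos (by linarith) (by linarith)
  · have hp : p < e := lt_of_le_of_ne hp hpe
    refine inverseSquareIntegral_ne_top (sub_pos.2 hp) ?_
    filter_upwards [hae] with x hx
    rw [abs_of_neg (by linarith)]; linarith

end GeneratingPair

/-! ### Herglotz representation on the disc -/

/-- The Schwarz integral formula: a holomorphic function is recovered from the boundary values of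
its real part. -/
lemma eq_im_add_circleAverage_herglotzRieszKernel {g : ℂ → ℂ}
    (hg : DifferentiableOn ℂ g (closedBall 0 1)) {w : ℂ} (hw : w ∈ ball (0 : ℂ) 1) :
    g w = Complex.I * (g 0).im +
      Real.circleAverage (fun ζ => herglotzRieszKernel 0 w ζ • ((g ζ).re : ℂ)) 0 1 := by
  have hgd : DiffContOnCl ℂ g (ball 0 1) :=
    DifferentiableOn.diffContOnCl (by rwa [closure_ball _ one_ne_zero])
  have hsph : ContinuousOn g (sphere 0 1) := hg.continuousOn.mono sphere_subset_closedBall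
  have hre : ContinuousOn (fun ζ => (g ζ).re) (sphere 0 1) :=
    Complex.continuous_re.comp_continuousOn hsph
  have hci : CircleIntegrable (fun ζ => (g ζ).re) 0 1 := hre.circleIntegrable zero_le_one
  have hcic : CircleIntegrable (fun ζ => ((g ζ).re : ℂ)) 0 1 :=
    (Complex.continuous_ofReal.comp_continuousOn hre).circleIntegrable zero_le_one
  set A : ℂ → ℂ := fun w =>
    Real.circleAverage (fun ζ => herglotzRieszKernel 0 w ζ • ((g ζ).re : ℂ)) 0 1 with hA
  -- Poisson's formula: g and the Schwarz integral A have the same real part, so g - A is a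
  -- constant, found at w = 0 by the mean value property.
  have hAre : ∀ w ∈ ball (0 : ℂ) 1, (A w).re = (g w).re := by
    intro w hw
    rw [hA, re_circleAverage_herglotzRieszKernel_smul hci hw]
    have hP := hgd.circleAverage_re_herglotzRieszKernel_smul hw
    have hHc : ContinuousOn (herglotzRieszKernel 0 w) (sphere 0 1) := by
      simpa using continuousOn_herglotzRieszKernel_sphere hw
    have hint : CircleIntegrable ((Complex.re ∘ herglotzRieszKernel 0 w) • g) 0 1 := by
      refine ContinuousOn.circleIntegrable zero_le_one ?_
      exact (Complex.continuous_re.comp_continuousOn hHc).smul hsph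
    have h1 := Complex.reCLM.circleAverage_comp_comm hint
    rw [hP] at h1
    rw [Complex.reCLM_apply] at h1
    rw [← h1]
    congr 1
    ext ζ
    simp
  have hA0 : A 0 = ((g 0).re : ℂ) := by
    have h1 : A 0 = Real.circleAverage (fun ζ => ((g ζ).re : ℂ)) 0 1 := by
      refine Real.circleAverage_congr_sphere fun ζ hζ => ?_
      have : ζ ≠ 0 := by
        rintro rfl; simp at hζ
      simp [herglotzRieszKernel_def, this]
    have h2 := Complex.ofRealCLM.circleAverage_comp_comm hci
    have h3 := Complex.reCLM.circleAverage_comp_comm (hsph.circleIntegrable zero_le_one)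
    have h4 : Real.circleAverage g 0 1 = g 0 := by
      have := hgd
      rw [← abs_one (α := ℝ)] at this
      exact this.circleAverage
    rw [h4] at h3
    rw [h1]
    have h5 : (fun ζ => ((g ζ).re : ℂ)) = Complex.ofRealCLM ∘ fun ζ => (g ζ).re := rfl
    rw [h5, h2]
    have h6 : (fun ζ => (g ζ).re) = Complex.reCLM ∘ g := rfl
    rw [h6, h3]
    rfl
  have han : AnalyticOnNhd ℂ (fun w => g w - A w) (ball 0 1) :=
    ((hg.mono ball_subset_closedBall).analyticOnNhd isOpen_ball).sub
      (analyticOnNhd_circleAverage_herglotzRieszKernel_smul hcic)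
  obtain ⟨c, hc⟩ := han.eq_const_of_re_eq_const (c₀ := 0)
    (fun w hw => by rw [Complex.sub_re, hAre w hw, sub_self]) isOpen_ball
    (isConnected_ball one_pos)
  have h0 := hc 0 (mem_ball_self one_pos)
  have h1 := hc w hw
  have h2 : g 0 - A 0 = Complex.I * (g 0).im := by
    rw [hA0]
    apply Complex.ext <;> simp
  have h3 : g w = (g w - A w) + A w := by ring
  rw [h3, h1, ← h0, h2]

/-- The measure `(2π)⁻¹ Re g(e^{iθ}) dθ` on `[0, 2π]`. -/
def boundaryRealPartMeasure (g : ℂ → ℂ) : Measure ℝ :=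
  (volume.restrict (Icc 0 (2 * Real.pi))).withDensity
    (fun θ => ENNReal.ofReal ((2 * Real.pi)⁻¹ * (g (circleMap 0 1 θ)).re))

section

variable {g : ℂ → ℂ}

lemma integral_boundaryRealPartMeasure (hg : ContinuousOn g (sphere 0 1))
    (hpos : ∀ ζ ∈ sphere (0 : ℂ) 1, 0 ≤ (g ζ).re) (f : ℂ → ℂ) :
    ∫ θ, f (circleMap 0 1 θ) ∂(boundaryRealPartMeasure g) =
      Real.circleAverage (fun ζ => f ζ • ((g ζ).re : ℂ)) 0 1 := by
  have hmem : ∀ θ : ℝ, circleMap (0 : ℂ) 1 θ ∈ sphere (0 : ℂ) 1 := fun θ =>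
    circleMap_mem_sphere _ zero_le_one _
  have hc : Continuous fun θ : ℝ => (g (circleMap 0 1 θ)).re :=
    Complex.continuous_re.comp (hg.comp_continuous (continuous_circleMap 0 1) hmem)
  rw [boundaryRealPartMeasure, integral_withDensity_eq_integral_toReal_smul
    (by have := hc.measurable; fun_prop) (by simp), Real.circleAverage_def,
    intervalIntegral.integral_of_le (by have := Real.pi_pos; positivity),
    integral_Icc_eq_integral_Ioc, ← integral_smul]
  congr 1; ext θ
  have h1 := hpos _ (hmem θ)
  have := Real.pi_pos
  rw [ENNReal.toReal_ofReal (by positivity), Complex.real_smul, Complex.real_smul, smul_eq_mul]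
  push_cast
  ring

/-- By the mean value property the mass depends only on g(0); for the dilates p(r w) it is therefore
the same for all r, which yields compactness. -/
lemma boundaryRealPartMeasure_univ (hg : DifferentiableOn ℂ g (closedBall 0 1))
    (hpos : ∀ ζ ∈ sphere (0 : ℂ) 1, 0 ≤ (g ζ).re) :
    boundaryRealPartMeasure g univ = ENNReal.ofReal (g 0).re := by
  have hsph : ContinuousOn g (sphere 0 1) := hg.continuousOn.mono sphere_subset_closedBall
  have hmem : ∀ θ : ℝ, circleMap (0 : ℂ) 1 θ ∈ sphere (0 : ℂ) 1 := fun θ =>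
    circleMap_mem_sphere _ zero_le_one _
  have hc : Continuous fun θ : ℝ => (2 * Real.pi)⁻¹ * (g (circleMap 0 1 θ)).re :=
    continuous_const.mul
      (Complex.continuous_re.comp (hsph.comp_continuous (continuous_circleMap 0 1) hmem))
  have hpi := Real.pi_pos
  have hgd : DiffContOnCl ℂ g (ball 0 |1|) := by
    rw [abs_one]
    exact DifferentiableOn.diffContOnCl (by rwa [closure_ball _ one_ne_zero])
  have h3 := Complex.reCLM.circleAverage_comp_comm (hsph.circleIntegrable zero_le_one)
  rw [hgd.circleAverage, Complex.reCLM_apply, Real.circleAverage_def,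
    intervalIntegral.integral_of_le (by positivity), ← integral_Icc_eq_integral_Ioc,
    smul_eq_mul, ← integral_const_mul] at h3
  rw [boundaryRealPartMeasure, withDensity_apply _ MeasurableSet.univ, Measure.restrict_univ,
    ← ofReal_integral_eq_lintegral_ofReal, ← h3]
  · rfl
  · exact hc.continuousOn.integrableOn_Icc
  · exact ae_of_all _ fun θ => mul_nonneg (by positivity) (hpos _ (hmem θ))

lemma boundaryRealPartMeasure_compl : boundaryRealPartMeasure g (Icc 0 (2 * Real.pi))ᶜ = 0 := by
  refine withDensity_absolutelyContinuous _ _ ?_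
  rw [Measure.restrict_apply measurableSet_Icc.compl, compl_inter_self, measure_empty]

end

lemma circleMap_sub_ne_zero {w : ℂ} (hw : ‖w‖ < 1) (θ : ℝ) : circleMap 0 1 θ - w ≠ 0 := by
  intro h
  have h1 : ‖circleMap 0 1 θ‖ = 1 := by simp
  rw [sub_eq_zero.1 h] at h1
  linarith

lemma continuous_herglotzRieszKernel_circleMap {w : ℂ} (hw : ‖w‖ < 1) :
    Continuous fun θ : ℝ => herglotzRieszKernel 0 w (circleMap 0 1 θ) := by
  simp only [herglotzRieszKernel_def, sub_zero]
  exact (by fun_prop : Continuous fun θ : ℝ => circleMap (0 : ℂ) 1 θ + w).div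
    (by fun_prop) (circleMap_sub_ne_zero hw)

lemma norm_herglotzRieszKernel_circleMap_le {w : ℂ} (hw : ‖w‖ < 1) (θ : ℝ) :
    ‖herglotzRieszKernel 0 w (circleMap 0 1 θ)‖ ≤ 2 / (1 - ‖w‖) := by
  have h1 : ‖circleMap 0 1 θ‖ = 1 := by simp
  simp only [herglotzRieszKernel_def, sub_zero]
  rw [norm_div]
  refine div_le_div₀ (by norm_num) ?_ (by linarith) ?_
  · refine (norm_add_le _ _).trans ?_
    linarith
  · have := norm_sub_norm_le (circleMap 0 1 θ) w
    linarith

/-- **Herglotz representation** of holomorphic functions on the disc with nonnegative real part. -/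
theorem exists_herglotz_representation {p : ℂ → ℂ} (hp : DifferentiableOn ℂ p (ball 0 1))
    (hpos : ∀ w ∈ ball (0 : ℂ) 1, 0 ≤ (p w).re) :
    ∃ m : Measure ℝ, IsFiniteMeasure m ∧ ∀ w ∈ ball (0 : ℂ) 1,
      p w = Complex.I * (p 0).im + ∫ θ, herglotzRieszKernel 0 w (circleMap 0 1 θ) ∂m := by
  -- Radii increasing to 1; the shift by 2 makes the first one 1/2 rather than 0.
  set r : ℕ → ℝ := fun n => 1 - 1 / ((n : ℝ) + 2) with hr
  have hr0 : ∀ n, 0 < r n := fun n => by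
    have h2 : (0 : ℝ) < (n : ℝ) + 2 := by positivity
    have : 1 / ((n : ℝ) + 2) < 1 := by
      rw [div_lt_one h2]
      have : (0 : ℝ) ≤ n := n.cast_nonneg
      linarith
    simp only [hr]; linarith
  have hr1 : ∀ n, r n < 1 := fun n => by
    have : 0 < 1 / ((n : ℝ) + 2) := by positivity
    simp only [hr]; linarith
  have hrlim : Tendsto r atTop (𝓝 1) := by
    have h1 := (tendsto_one_div_add_atTop_nhds_zero_nat (𝕜 := ℝ)).comp (tendsto_add_atTop_nat 1)
    have h2 := (tendsto_const_nhds (x := (1 : ℝ))).sub h1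
    rw [sub_zero] at h2
    refine h2.congr fun n => ?_
    simp only [hr, Function.comp_apply]
    push_cast
    ring
  have hmaps : ∀ n, MapsTo (fun w : ℂ => (r n : ℂ) * w) (closedBall 0 1) (ball 0 1) := by
    intro n w hw
    rw [mem_closedBall_zero_iff] at hw
    rw [mem_ball_zero_iff, norm_mul, Complex.norm_real, Real.norm_of_nonneg (hr0 n).le]
    nlinarith [hr0 n, hr1 n, norm_nonneg w]
  set g : ℕ → ℂ → ℂ := fun n w => p (r n * w) with hg
  have hgd : ∀ n, DifferentiableOn ℂ (g n) (closedBall 0 1) := fun n =>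
    hp.comp (by fun_prop) (hmaps n)
  have hgpos : ∀ n, ∀ ζ ∈ sphere (0 : ℂ) 1, 0 ≤ (g n ζ).re := fun n ζ hζ =>
    hpos _ (hmaps n (sphere_subset_closedBall hζ))
  have hg0 : ∀ n, g n 0 = p 0 := fun n => by simp [hg]
  have huniv : ∀ n, boundaryRealPartMeasure (g n) univ = ENNReal.ofReal (p 0).re := fun n => by
    rw [boundaryRealPartMeasure_univ (hgd n) (hgpos n), hg0]
  have hfin : ∀ n, IsFiniteMeasure (boundaryRealPartMeasure (g n)) := fun n =>
    ⟨by rw [huniv n]; exact ENNReal.ofReal_lt_top⟩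
  set M : ℕ → FiniteMeasure ℝ := fun n => ⟨boundaryRealPartMeasure (g n), hfin n⟩ with hM
  -- Bounded mass and a fixed compact carrier give weak compactness; a limit along an ultrafilter
  -- then replaces extracting a subsequence.
  set K := {ν : FiniteMeasure ℝ | ν.mass ≤ (p 0).re.toNNReal ∧ ν (Icc 0 (2 * Real.pi))ᶜ = 0}
  have hK : IsCompact K := isCompact_setOfPred_finiteMeasure_le_of_isCompact _ isCompact_Icc
  have hMK : ∀ n, M n ∈ K := by
    intro n
    refine ⟨?_, ?_⟩
    · rw [← ENNReal.coe_le_coe, FiniteMeasure.ennreal_mass]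
      exact (huniv n).le
    · rw [← ENNReal.coe_eq_zero, FiniteMeasure.ennreal_coeFn_eq_coeFn_toMeasure]
      exact boundaryRealPartMeasure_compl
  set U : Ultrafilter ℕ := hyperfilter ℕ with hU
  have hUle : (U : Filter ℕ) ≤ atTop := by
    rw [← Nat.cofinite_eq_atTop]; exact hyperfilter_le_cofinite
  obtain ⟨ν, -, hν⟩ := isCompact_iff_ultrafilter_le_nhds'.1 hK (U.map M)
    (Ultrafilter.mem_map.2 (Eventually.of_forall hMK))
  have hlim : Tendsto M U (𝓝 ν) := hν
  refine ⟨ν, inferInstance, fun w hw => ?_⟩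
  have hw1 : ‖w‖ < 1 := mem_ball_zero_iff.1 hw
  rw [FiniteMeasure.tendsto_iff_forall_integral_rclike_tendsto ℂ] at hlim
  have h1 := hlim (BoundedContinuousFunction.ofNormedAddCommGroup _
    (continuous_herglotzRieszKernel_circleMap hw1) _ (norm_herglotzRieszKernel_circleMap_le hw1))
  have h2 : Tendsto (fun n => g n w) U (𝓝 (p w)) := by
    have hpc : ContinuousAt p w := (hp.differentiableAt (isOpen_ball.mem_nhds hw)).continuousAt
    have h3 : Tendsto (fun n => (r n : ℂ) * w) U (𝓝 w) := by
      have := ((Complex.continuous_ofReal.tendsto 1).comp (hrlim.mono_left hUle)).mul_const w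
      simpa using this
    exact hpc.tendsto.comp h3
  have h3 := (tendsto_const_nhds (x := Complex.I * ((p 0).im : ℂ))).add h1
  refine tendsto_nhds_unique (h2.congr fun n => ?_) h3
  have h4 := eq_im_add_circleAverage_herglotzRieszKernel (hgd n) hw
  rw [← integral_boundaryRealPartMeasure ((hgd n).continuousOn.mono sphere_subset_closedBall)
    (hgpos n), hg0] at h4
  exact h4

/-! ### Existence of the generating pair -/

lemma differentiableAt_cauchyTransform (μ : Measure ℝ) [IsFiniteMeasure μ] {z : ℂ}
    (hz : 0 < z.im) : DifferentiableAt ℂ (cauchyTransform μ) z := by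
  have hz2 : 0 < z.im / 2 := half_pos hz
  have him : ∀ v ∈ ball z (z.im / 2), z.im / 2 < v.im := by
    intro v hv
    rw [mem_ball, dist_comm, Complex.dist_eq] at hv
    have h1 := (Complex.abs_im_le_norm (z - v)).trans_lt hv
    rw [Complex.sub_im] at h1
    linarith [(abs_lt.1 h1).2]
  refine (hasDerivAt_integral_of_dominated_loc_of_deriv_le (𝕜 := ℂ) (μ := μ)
    (F := fun z (x : ℝ) => 1 / (z - (x : ℂ))) (F' := fun z (x : ℝ) => -1 / (z - (x : ℂ)) ^ 2)
    (bound := fun _ => 1 / (z.im / 2) ^ 2)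
    (ball_mem_nhds z hz2) ?_ (integrable_one_div_sub_ofReal μ hz) ?_ ?_ (integrable_const _)
    ?_).2.differentiableAt
  · exact Eventually.of_forall fun v => Measurable.aestronglyMeasurable (by fun_prop)
  · exact Measurable.aestronglyMeasurable (by fun_prop)
  · refine ae_of_all _ fun x v hv => ?_
    rw [norm_div, norm_neg, norm_one, norm_pow]
    have := (him v hv).le.trans (im_le_norm_sub_ofReal v x)
    gcongr
  · refine ae_of_all _ fun x v hv => ?_
    have h0 := sub_ofReal_ne_zero (hz2.trans (him v hv)) x
    simpa [Pi.inv_def] using ((hasDerivAt_id' v).sub_const (x : ℂ)).inv h0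

lemma differentiableAt_selfEnergy (μ : Measure ℝ) [IsProbabilityMeasure μ] {z : ℂ}
    (hz : 0 < z.im) : DifferentiableAt ℂ (selfEnergy μ) z :=
  differentiableAt_id.sub ((differentiableAt_const _).div (differentiableAt_cauchyTransform μ hz)
    (cauchyTransform_ne_zero μ hz))

lemma im_cayley_pos {w : ℂ} (hw : ‖w‖ < 1) : 0 < (Complex.I * (1 + w) / (1 - w)).im := by
  have hw1 : 1 - w ≠ 0 := by
    intro h
    rw [← sub_eq_zero.1 h, norm_one] at hw
    exact lt_irrefl _ hw
  have h1 : Complex.normSq w < 1 := by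
    rw [Complex.normSq_eq_norm_sq]; nlinarith [norm_nonneg w]
  have h2 : (Complex.I * (1 + w) / (1 - w)).im =
      (1 - Complex.normSq w) / Complex.normSq (1 - w) := by
    rw [Complex.div_im, ← sub_div]
    congr 1
    simp [Complex.normSq_apply]
    ring
  rw [h2]
  exact div_pos (by linarith) (Complex.normSq_pos.2 hw1)

lemma norm_inverse_cayley_lt_one {z : ℂ} (hz : 0 < z.im) :
    ‖(z - Complex.I) / (z + Complex.I)‖ < 1 := by
  have h1 : z + Complex.I ≠ 0 := by
    intro h
    have := congrArg Complex.im h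
    simp at this
    linarith
  rw [norm_div, div_lt_one (norm_pos_iff.2 h1), ← sq_lt_sq₀ (norm_nonneg _) (norm_nonneg _),
    ← Complex.normSq_eq_norm_sq, ← Complex.normSq_eq_norm_sq]
  simp [Complex.normSq_apply]
  nlinarith

lemma cayley_inverse_cayley {z : ℂ} (hz : 0 < z.im) :
    Complex.I * (1 + (z - Complex.I) / (z + Complex.I)) /
      (1 - (z - Complex.I) / (z + Complex.I)) = z := by
  have h1 : z + Complex.I ≠ 0 := by
    intro h
    have := congrArg Complex.im h
    simp at this
    linarith
  have h2 : 1 - (z - Complex.I) / (z + Complex.I) = 2 * Complex.I / (z + Complex.I) := by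
    field_simp; ring
  rw [h2]
  have := Complex.I_ne_zero
  field_simp
  ring

/-- The Herglotz kernel in half-plane coordinates. -/
lemma herglotzRieszKernel_inverse_cayley {z : ℂ} (hz : 0 < z.im) (θ : ℝ) :
    herglotzRieszKernel 0 ((z - Complex.I) / (z + Complex.I)) (circleMap 0 1 θ) =
      if Real.sin (θ / 2) = 0 then -(Complex.I * z) else
        Complex.I * ((1 + ((-(Real.cos (θ / 2) / Real.sin (θ / 2)) : ℝ) : ℂ) * z) /
          (z - ((-(Real.cos (θ / 2) / Real.sin (θ / 2)) : ℝ) : ℂ))) := by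
  -- Half angles: with e = e^{iθ/2} = c + is, the boundary point e² corresponds to x = -cot(θ/2),
  -- and to infinity when s = 0.
  set c := Real.cos (θ / 2) with hc
  set s := Real.sin (θ / 2) with hs
  have hcs : (c : ℂ) ^ 2 + (s : ℂ) ^ 2 = 1 := by
    have := Real.cos_sq_add_sin_sq (θ / 2)
    exact_mod_cast this
  have hzI : z + Complex.I ≠ 0 := by
    intro h
    have := congrArg Complex.im h
    simp at this
    linarith
  have hζ : circleMap 0 1 θ = ((c : ℂ) + s * Complex.I) ^ 2 := by
    have h1 : Complex.exp ((θ / 2 : ℝ) * Complex.I) = (c : ℂ) + s * Complex.I := by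
      rw [Complex.exp_mul_I, hc, hs, Complex.ofReal_cos, Complex.ofReal_sin]
    rw [← h1, ← Complex.exp_nat_mul, circleMap]
    simp only [Complex.ofReal_one, one_mul, zero_add]
    congr 1
    push_cast
    ring
  have hne : circleMap 0 1 θ - (z - Complex.I) / (z + Complex.I) ≠ 0 :=
    circleMap_sub_ne_zero (norm_inverse_cayley_lt_one hz) θ
  have hden : circleMap 0 1 θ * (z + Complex.I) - (z - Complex.I) ≠ 0 := by
    intro h
    apply hne
    rw [sub_eq_zero, eq_div_iff hzI]
    exact sub_eq_zero.1 h
  have hH : herglotzRieszKernel 0 ((z - Complex.I) / (z + Complex.I)) (circleMap 0 1 θ) =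
      (circleMap 0 1 θ * (z + Complex.I) + (z - Complex.I)) /
        (circleMap 0 1 θ * (z + Complex.I) - (z - Complex.I)) := by
    rw [herglotzRieszKernel_def, sub_zero, sub_zero, ← mul_div_mul_right _ _ hzI, add_mul, sub_mul,
      div_mul_cancel₀ _ hzI]
  have hI := Complex.I_sq
  set e : ℂ := (c : ℂ) + s * Complex.I
  have he : e * ((c : ℂ) - s * Complex.I) = 1 := by
    linear_combination hcs - (s : ℂ) ^ 2 * hI
  have he0 : e ≠ 0 := left_ne_zero_of_mul_eq_one he
  have hnum : circleMap 0 1 θ * (z + Complex.I) + (z - Complex.I) = 2 * e * (c * z - s) := by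
    rw [hζ]
    linear_combination 2 * s * e * hI - (z - Complex.I) * he
  have hden' : circleMap 0 1 θ * (z + Complex.I) - (z - Complex.I) =
      2 * e * (Complex.I * (c + s * z)) := by
    rw [hζ]
    linear_combination (z - Complex.I) * he
  have hcz : (c : ℂ) + s * z ≠ 0 := by
    intro h
    rw [hden', h] at hden
    simp at hden
  rw [hH, hnum, hden', mul_div_mul_left _ _ (mul_ne_zero two_ne_zero he0)]
  have hI0 := Complex.I_ne_zero
  split_ifs with h0
  · have hc0 : (c : ℂ) ≠ 0 := by simpa [h0] using hcz
    rw [h0]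
    simp only [Complex.ofReal_zero, zero_mul, add_zero, sub_zero]
    rw [div_eq_iff (mul_ne_zero hI0 hc0)]
    linear_combination c * z * hI
  · have hs0 : (s : ℂ) ≠ 0 := by exact_mod_cast h0
    push_cast
    have h1 : 1 + -((c : ℂ) / s) * z = -(c * z - s) / s := by field_simp; ring
    have h2 : z - -((c : ℂ) / s) = (c + s * z) / s := by field_simp; ring
    rw [h1, h2, div_div_div_cancel_right₀ hs0, ← mul_div_assoc,
      div_eq_div_iff (mul_ne_zero hI0 hcz) hcz]
    linear_combination (c * z - s) * (c + s * z) * hI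

lemma tendsto_div_mul_I_atTop (a : ℂ) :
    Tendsto (fun y : ℝ => a / (y * Complex.I)) atTop (𝓝 0) := by
  have h3 : Tendsto (fun y : ℝ => ((y⁻¹ : ℝ) : ℂ)) atTop (𝓝 0) :=
    (Complex.continuous_ofReal.tendsto' 0 0 Complex.ofReal_zero).comp tendsto_inv_atTop_zero
  have h4 := h3.const_mul (a / Complex.I)
  rw [mul_zero] at h4
  refine h4.congr fun y => ?_
  push_cast
  rw [← div_eq_mul_inv, div_div, mul_comm]

lemma ofReal_mul_I_im_pos {y : ℝ} (hy : 0 < y) : 0 < ((y : ℂ) * Complex.I).im := by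
  simpa using hy

lemma ofReal_mul_I_ne_zero {y : ℝ} (hy : 0 < y) : (y : ℂ) * Complex.I ≠ 0 :=
  mul_ne_zero (by exact_mod_cast hy.ne') Complex.I_ne_zero

/-- `i y G(i y) → 1` as `y → ∞`. -/
lemma tendsto_mul_cauchyTransform_atTop (μ : Measure ℝ) [IsProbabilityMeasure μ] :
    Tendsto (fun y : ℝ => (y * Complex.I) * cauchyTransform μ (y * Complex.I)) atTop (𝓝 1) := by
  have hlim : Tendsto (fun y : ℝ => ∫ x : ℝ, (y * Complex.I) * (1 / (y * Complex.I - (x : ℂ))) ∂μ)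
      atTop (𝓝 (∫ _ : ℝ, (1 : ℂ) ∂μ)) := by
    refine tendsto_integral_filter_of_dominated_convergence (fun _ => 1) ?_ ?_
      (integrable_const _) ?_
    · exact Eventually.of_forall fun y => Measurable.aestronglyMeasurable (by fun_prop)
    · filter_upwards [eventually_gt_atTop 0] with y hy
      refine ae_of_all _ fun x => ?_
      have hz : 0 < ((y : ℂ) * Complex.I).im := by simpa using hy
      have h1 := im_le_norm_sub_ofReal ((y : ℂ) * Complex.I) x
      have h2 := hz.trans_le h1
      rw [mul_one_div, norm_div, div_le_one h2]
      simpa [abs_of_pos hy] using h1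
    · refine ae_of_all _ fun x => ?_
      have h1 : Tendsto (fun y : ℝ => 1 - (x : ℂ) / (y * Complex.I)) atTop (𝓝 1) := by
        simpa using tendsto_const_nhds.sub (tendsto_div_mul_I_atTop (x : ℂ))
      have h5 := h1.inv₀ one_ne_zero
      rw [inv_one] at h5
      refine h5.congr' ?_
      filter_upwards [eventually_gt_atTop 0] with y hy
      have hz := ofReal_mul_I_im_pos hy
      have hz0 := ofReal_mul_I_ne_zero hy
      have h6 := sub_ofReal_ne_zero hz x
      have h7 : 1 - (x : ℂ) / (y * Complex.I) = (y * Complex.I - x) / (y * Complex.I) := by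
        rw [sub_div, div_self hz0]
      rw [h7, inv_div, mul_one_div]
  simp only [integral_const, probReal_univ, one_smul] at hlim
  refine hlim.congr fun y => ?_
  rw [cauchyTransform, integral_const_mul]

/-- `K(i y) / (i y) → 0` as `y → ∞`. -/
lemma tendsto_selfEnergy_div_atTop (μ : Measure ℝ) [IsProbabilityMeasure μ] :
    Tendsto (fun y : ℝ => selfEnergy μ (y * Complex.I) / (y * Complex.I)) atTop (𝓝 0) := by
  have h1 := (tendsto_mul_cauchyTransform_atTop μ).inv₀ one_ne_zero
  have h2 := (tendsto_const_nhds (x := (1 : ℂ))).sub h1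
  rw [inv_one, sub_self] at h2
  refine h2.congr' ?_
  filter_upwards [eventually_gt_atTop 0] with y hy
  have hz := ofReal_mul_I_im_pos hy
  have hz0 := ofReal_mul_I_ne_zero hy
  rw [selfEnergy, fTransform, sub_div, div_self hz0, div_div, mul_comm, one_div]

lemma tendsto_integral_tilted_kernel_div_atTop (τ : Measure ℝ) [IsFiniteMeasure τ] :
    Tendsto (fun y : ℝ => (∫ x : ℝ, (1 + (x : ℂ) * (y * Complex.I)) /
      (y * Complex.I - (x : ℂ)) ∂τ) / (y * Complex.I)) atTop (𝓝 0) := by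
  have hlim : Tendsto (fun y : ℝ => ∫ x : ℝ, (1 + (x : ℂ) * (y * Complex.I)) /
      (y * Complex.I - (x : ℂ)) / (y * Complex.I) ∂τ) atTop (𝓝 (∫ _ : ℝ, (0 : ℂ) ∂τ)) := by
    refine tendsto_integral_filter_of_dominated_convergence (fun _ => 1) ?_ ?_
      (integrable_const _) ?_
    · exact Eventually.of_forall fun y => Measurable.aestronglyMeasurable (by fun_prop)
    · filter_upwards [eventually_ge_atTop 1] with y hy
      refine ae_of_all _ fun x => ?_
      have hy0 : 0 < y := by linarith
      have hz : 0 < ((y : ℂ) * Complex.I).im := by simpa using hy0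
      have h1 := norm_pos_iff.2 (sub_ofReal_ne_zero hz x)
      have h2 : ‖(y : ℂ) * Complex.I‖ = y := by simp [abs_of_pos hy0]
      -- The squared bound reads 1 + x²y² ≤ (x² + y²) y², true once y ≥ 1.
      rw [div_div, norm_div, norm_mul, h2, div_le_one (by positivity),
        ← sq_le_sq₀ (norm_nonneg _) (by positivity), mul_pow, ← Complex.normSq_eq_norm_sq,
        ← Complex.normSq_eq_norm_sq, normSq_sub_ofReal, Complex.normSq_apply]
      simp
      have h3 : 1 ≤ y ^ 2 := by nlinarith
      nlinarith [sq_nonneg x]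
    · refine ae_of_all _ fun x => ?_
      have hinv : Tendsto (fun y : ℝ => ((y : ℂ) * Complex.I)⁻¹) atTop (𝓝 0) := by
        simpa only [one_div] using tendsto_div_mul_I_atTop 1
      have h5 : Tendsto (fun y : ℝ => (((y : ℂ) * Complex.I)⁻¹ + x) *
          ((1 - x * ((y : ℂ) * Complex.I)⁻¹)⁻¹ * ((y : ℂ) * Complex.I)⁻¹)) atTop
          (𝓝 ((0 + (x : ℂ)) * ((1 - (x : ℂ) * 0)⁻¹ * 0))) := by
        refine (hinv.add tendsto_const_nhds).mul (Tendsto.mul (Tendsto.inv₀ ?_ (by simp)) hinv)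
        exact tendsto_const_nhds.sub (tendsto_const_nhds.mul hinv)
      simp only [mul_zero] at h5
      refine h5.congr' ?_
      filter_upwards [eventually_gt_atTop 0] with y hy
      have hz := ofReal_mul_I_im_pos hy
      have hz0 := ofReal_mul_I_ne_zero hy
      have h6 := sub_ofReal_ne_zero hz x
      generalize (y : ℂ) * Complex.I = v at hz0 h6
      have h7 : 1 - (x : ℂ) * v⁻¹ = (v - x) / v := by field_simp
      rw [h7]
      field_simp
  simp only [integral_zero] at hlim
  refine hlim.congr fun y => ?_
  rw [integral_div]

/-- **Existence of the Boolean generating pair** of a probability measure. -/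
theorem exists_isBooleanGeneratingPair (μ : Measure ℝ) [IsProbabilityMeasure μ] :
    ∃ τ : Measure ℝ, ∃ b : ℝ, IsBooleanGeneratingPair μ b τ := by
  set ψ : ℂ → ℂ := fun w => Complex.I * (1 + w) / (1 - w) with hψ
  set p : ℂ → ℂ := fun w => Complex.I * selfEnergy μ (ψ w) with hp
  have hψpos : ∀ w ∈ ball (0 : ℂ) 1, 0 < (ψ w).im := fun w hw =>
    im_cayley_pos (mem_ball_zero_iff.1 hw)
  have hpd : DifferentiableOn ℂ p (ball 0 1) := by
    intro w hw
    have hw1 : 1 - w ≠ 0 := by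
      intro h
      rw [mem_ball_zero_iff, ← sub_eq_zero.1 h, norm_one] at hw
      exact lt_irrefl _ hw
    have h1 : DifferentiableAt ℂ ψ w :=
      DifferentiableAt.div (by fun_prop) (by fun_prop) hw1
    exact (((differentiableAt_selfEnergy μ (hψpos w hw)).comp w h1).const_mul
      Complex.I).differentiableWithinAt
  have hpos : ∀ w ∈ ball (0 : ℂ) 1, 0 ≤ (p w).re := by
    intro w hw
    have := selfEnergy_im_nonpos μ (hψpos w hw)
    simp only [hp, Complex.I_mul_re]
    linarith
  obtain ⟨m, hm, hrep⟩ := exists_herglotz_representation hpd hpos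
  set X : ℝ → ℝ := fun θ => -(Real.cos (θ / 2) / Real.sin (θ / 2)) with hX
  have hXm : Measurable X := by fun_prop
  -- The angles sent to infinity by the Cayley transform; their mass would contribute a term linear
  -- in z to K.
  set N : Set ℝ := {θ | Real.sin (θ / 2) = 0} with hN
  have hNm : MeasurableSet N := measurableSet_eq_fun (by fun_prop) measurable_const
  set τ : Measure ℝ := (m.restrict Nᶜ).map X with hτ
  set b : ℝ := (p 0).im with hb
  have hK : ∀ z : ℂ, 0 < z.im → selfEnergy μ z =
      b + ∫ x : ℝ, (1 + (x : ℂ) * z) / (z - (x : ℂ)) ∂τ - (m.real N : ℂ) * z := by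
    intro z hz
    have hwn := norm_inverse_cayley_lt_one hz
    have h1 := hrep _ (mem_ball_zero_iff.2 hwn)
    have hint : Integrable (fun θ => herglotzRieszKernel 0 ((z - Complex.I) / (z + Complex.I))
        (circleMap 0 1 θ)) m :=
      Integrable.of_bound (continuous_herglotzRieszKernel_circleMap hwn).aestronglyMeasurable _
        (ae_of_all _ (norm_herglotzRieszKernel_circleMap_le hwn))
    have h2 : p ((z - Complex.I) / (z + Complex.I)) = Complex.I * selfEnergy μ z := by
      simp only [hp, hψ]
      rw [cayley_inverse_cayley hz]
    have h3 : ∫ θ in N, herglotzRieszKernel 0 ((z - Complex.I) / (z + Complex.I))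
        (circleMap 0 1 θ) ∂m = -(Complex.I * z) * m.real N := by
      rw [setIntegral_congr_fun (g := fun _ => -(Complex.I * z)) hNm fun θ hθ => by
        exact (herglotzRieszKernel_inverse_cayley hz θ).trans (if_pos hθ), setIntegral_const,
        Complex.real_smul, mul_comm]
    have h4 : ∫ θ in Nᶜ, herglotzRieszKernel 0 ((z - Complex.I) / (z + Complex.I))
        (circleMap 0 1 θ) ∂m =
        Complex.I * ∫ x : ℝ, (1 + (x : ℂ) * z) / (z - (x : ℂ)) ∂τ := by
      rw [hτ, integral_map hXm.aemeasurable
        (continuous_tilted_kernel hz).aestronglyMeasurable, ← integral_const_mul]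
      refine setIntegral_congr_fun hNm.compl fun θ hθ => ?_
      exact (herglotzRieszKernel_inverse_cayley hz θ).trans (if_neg hθ)
    rw [h2, ← integral_add_compl hNm hint, h3, h4] at h1
    refine mul_left_cancel₀ Complex.I_ne_zero (h1.trans ?_)
    ring
  -- Divide by z = iy and let y → ∞: K(z), b and the integral are all o(z), so the linear
  -- coefficient is 0.
  have hmass : m.real N = 0 := by
    have h1 := tendsto_integral_tilted_kernel_div_atTop τ
    have h2 := tendsto_selfEnergy_div_atTop μ
    have h3 := tendsto_div_mul_I_atTop (b : ℂ)
    have h4 := (h3.add h1).sub h2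
    rw [add_zero, sub_zero] at h4
    have h5 : Tendsto (fun _ : ℝ => (m.real N : ℂ)) atTop (𝓝 0) := by
      refine h4.congr' ?_
      filter_upwards [eventually_gt_atTop 0] with y hy
      have hz := ofReal_mul_I_im_pos hy
      have hz0 := ofReal_mul_I_ne_zero hy
      rw [hK _ hz, sub_div, add_div, mul_div_cancel_right₀ _ hz0]
      ring
    exact_mod_cast tendsto_nhds_unique tendsto_const_nhds h5
  refine ⟨τ, b, inferInstance, fun z hz => ?_⟩
  rw [hK z hz, hmass]
  simp

lemma isBooleanGeneratingPair_booleanGeneratingMeasure (μ : Measure ℝ) [IsProbabilityMeasure μ] :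
    ∃ b : ℝ, IsBooleanGeneratingPair μ b (booleanGeneratingMeasure μ) := by
  have h := exists_isBooleanGeneratingPair μ
  rw [booleanGeneratingMeasure, dif_pos h]
  exact h.choose_spec

/-! ### Unimodal versions of k and the structure of μ -/

lemma booleanK_ae_eq (μ : Measure ℝ) [IsFiniteMeasure (booleanGeneratingMeasure μ)] :
    booleanK μ =ᵐ[volume] fun x =>
      ((tilted (booleanGeneratingMeasure μ)).rnDeriv volume x).toReal / |x| :=
  rnDeriv_levy_ae_eq (booleanGeneratingMeasure μ)

/-- The version is d(x)/|x| with d the upper density of σ, monotone at every point and not just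
almost everywhere. -/
theorem IsBooleanSelfdecomposable.exists_isUnimodalVersion {μ : Measure ℝ}
    (hμ : IsBooleanSelfdecomposable μ) : ∃ k : ℝ → ℝ, IsUnimodalVersion μ k := by
  have := hμ.1
  obtain ⟨b, h⟩ := isBooleanGeneratingPair_booleanGeneratingMeasure μ
  have := h.1
  refine ⟨fun x => (upperDensity (tilted (booleanGeneratingMeasure μ)) x).toReal / |x|,
    fun x _ => by positivity, ?_, fun x hx y hy hxy => ?_, fun x hx y hy hxy => ?_⟩
  · filter_upwards [booleanK_ae_eq μ,
      upperDensity_ae_eq (tilted (booleanGeneratingMeasure μ))] with x h1 h2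
    rw [h1, h2]
  · have hx : x < 0 := hx
    have hy : y < 0 := hy
    exact hμ.upperDensity_toReal_div_le h hy.ne (div_pos_of_neg_of_neg hy hx)
      ((div_le_one_of_neg hx).2 hxy)
  · have hx : 0 < x := hx
    have hy : 0 < y := hy
    exact hμ.upperDensity_toReal_div_le h hx.ne' (div_pos hx hy) ((div_le_one hy).2 hxy)

section Version

variable {μ : Measure ℝ} {k : ℝ → ℝ}

lemma IsUnimodalVersion.pos (hk : IsUnimodalVersion μ k) {x : ℝ} (hx : x ≠ 0) (hkx : k x ≠ 0) :
    0 < k x :=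
  lt_of_le_of_ne (hk.1 x hx) hkx.symm

lemma IsUnimodalVersion.le_of_mem_uIoc (hk : IsUnimodalVersion μ k) {w x : ℝ}
    (hx : x ∈ uIoc 0 w) (hx0 : x ≠ 0) : k w ≤ k x := by
  rw [mem_uIoc] at hx
  rcases hx with ⟨h1, h2⟩ | ⟨h1, h2⟩
  · exact hk.2.2.2 h1 (h1.trans_le h2) h2
  · have hx' : x < 0 := lt_of_le_of_ne h2 hx0
    exact hk.2.2.1 (h1.trans hx') hx' h1.le

lemma IsUnimodalVersion.ae_eq_rnDeriv [IsProbabilityMeasure μ] (hk : IsUnimodalVersion μ k) :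
    k =ᵐ[volume] fun x =>
      ((tilted (booleanGeneratingMeasure μ)).rnDeriv volume x).toReal / |x| := by
  obtain ⟨b, h⟩ := isBooleanGeneratingPair_booleanGeneratingMeasure μ
  have := h.1
  exact hk.2.1.trans (booleanK_ae_eq μ)

lemma leftEnd_le {x : ℝ} (hx : x ≠ 0) (hkx : k x ≠ 0) : leftEnd k ≤ x :=
  sInf_le ⟨x, ⟨hx, hkx⟩, rfl⟩

lemma le_rightEnd {x : ℝ} (hx : x ≠ 0) (hkx : k x ≠ 0) : (x : EReal) ≤ rightEnd k :=
  le_sSup ⟨x, ⟨hx, hkx⟩, rfl⟩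

lemma EReal.nonneg_of_forall_neg_le {a : EReal} (h : ∀ y : ℝ, y < 0 → (y : EReal) ≤ a) : 0 ≤ a := by
  by_contra! ha
  obtain ⟨q, h1, h2⟩ := EReal.lt_iff_exists_real_btwn.1 ha
  exact absurd (h q (by exact_mod_cast h2)) (not_le.2 h1)

lemma EReal.nonpos_of_forall_le_pos {a : EReal} (h : ∀ y : ℝ, 0 < y → a ≤ (y : EReal)) : a ≤ 0 := by
  by_contra! ha
  obtain ⟨q, h1, h2⟩ := EReal.lt_iff_exists_real_btwn.1 ha
  exact absurd (h q (by exact_mod_cast h1)) (not_le.2 h2)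

/-- If k(w) ≠ 0 with w > 0, then k > 0 on all of (0, w], so the infimum is still at most 0. -/
lemma IsUnimodalVersion.leftEnd_nonpos (hk : IsUnimodalVersion μ k) {w : ℝ} (hw : w ≠ 0)
    (hkw : k w ≠ 0) : leftEnd k ≤ 0 := by
  rcases lt_or_gt_of_ne hw with h | h
  · exact (leftEnd_le hw hkw).trans (by exact_mod_cast h.le)
  · refine EReal.nonpos_of_forall_le_pos fun y hy => ?_
    have hm : 0 < min w y := lt_min h hy
    have := hk.le_of_mem_uIoc (w := w) (mem_uIoc.2 (Or.inl ⟨hm, min_le_left w y⟩)) hm.ne'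
    refine (leftEnd_le hm.ne' ((hk.pos hw hkw).trans_le this).ne').trans ?_
    exact_mod_cast min_le_right w y

lemma IsUnimodalVersion.rightEnd_nonneg (hk : IsUnimodalVersion μ k) {w : ℝ} (hw : w ≠ 0)
    (hkw : k w ≠ 0) : 0 ≤ rightEnd k := by
  rcases lt_or_gt_of_ne hw with h | h
  · refine EReal.nonneg_of_forall_neg_le fun y hy => ?_
    rcases lt_or_ge w y with hwy | hwy
    · have := hk.le_of_mem_uIoc (w := w) (mem_uIoc.2 (Or.inr ⟨hwy, hy.le⟩)) hy.ne
      exact le_rightEnd hy.ne ((hk.pos hw hkw).trans_le this).ne'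
    · exact le_trans (by exact_mod_cast hwy) (le_rightEnd hw hkw)
  · exact le_trans (by exact_mod_cast h.le) (le_rightEnd hw hkw)

/-- Take w beyond u, as seen from 0, with k(w) ≠ 0; half the distance from u to {0, w} keeps the
ball between 0 and w, where k ≥ k(w). -/
lemma IsUnimodalVersion.exists_dominating_ball (hk : IsUnimodalVersion μ k) {u : ℝ}
    (hu0 : u ≠ 0) (hl : leftEnd k < u) (hr : (u : EReal) < rightEnd k) :
    ∃ w : ℝ, ∃ r : ℝ, 0 < k w ∧ 0 < r ∧ ∀ x ∈ closedBall u r, x ≠ 0 → k w ≤ k x := by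
  rcases lt_or_gt_of_ne hu0 with h | h
  · obtain ⟨_, ⟨w, ⟨hw0, hkw⟩, rfl⟩, hwu⟩ := sInf_lt_iff.1 hl
    have hwu : w < u := EReal.coe_lt_coe_iff.1 hwu
    have hm : 0 < min (u - w) (-u) := lt_min (by linarith) (by linarith)
    refine ⟨w, min (u - w) (-u) / 2, hk.pos hw0 hkw, half_pos hm, fun x hx hx0 => ?_⟩
    rw [Real.closedBall_eq_Icc] at hx
    have h1 := min_le_left (u - w) (-u)
    have h2 := min_le_right (u - w) (-u)
    exact hk.le_of_mem_uIoc (mem_uIoc.2 (Or.inr ⟨by linarith [hx.1], by linarith [hx.2]⟩)) hx0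
  · obtain ⟨_, ⟨w, ⟨hw0, hkw⟩, rfl⟩, hwu⟩ := lt_sSup_iff.1 hr
    have hwu : u < w := EReal.coe_lt_coe_iff.1 hwu
    have hm : 0 < min (w - u) u := lt_min (by linarith) h
    refine ⟨w, min (w - u) u / 2, hk.pos hw0 hkw, half_pos hm, fun x hx hx0 => ?_⟩
    rw [Real.closedBall_eq_Icc] at hx
    have h1 := min_le_left (w - u) u
    have h2 := min_le_right (w - u) u
    exact hk.le_of_mem_uIoc (mem_uIoc.2 (Or.inl ⟨by linarith [hx.1], by linarith [hx.2]⟩)) hx0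

lemma IsUnimodalVersion.measure_singleton_zero [IsProbabilityMeasure μ]
    (hk : IsUnimodalVersion μ k) {w : ℝ} (hw : w ≠ 0) (hkw : k w ≠ 0) : μ {0} = 0 := by
  obtain ⟨b, h⟩ := isBooleanGeneratingPair_booleanGeneratingMeasure μ
  have h1 := measure_singleton_mul_lintegral_le_one h 0
  rw [lintegral_tilted_inv_sq_eq_top h hk.ae_eq_rnDeriv hw (hk.pos hw hkw)
    fun x hx hx0 => hk.le_of_mem_uIoc hx hx0] at h1
  by_contra h0
  rw [ENNReal.mul_top h0] at h1
  simp at h1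

lemma IsUnimodalVersion.restrict_absolutelyContinuous [IsProbabilityMeasure μ]
    (hk : IsUnimodalVersion μ k) {w : ℝ} (hw : w ≠ 0) (hkw : k w ≠ 0) :
    μ.restrict {x : ℝ | leftEnd k < (x : EReal) ∧ (x : EReal) < rightEnd k} ≪ volume := by
  obtain ⟨b, h⟩ := isBooleanGeneratingPair_booleanGeneratingMeasure μ
  refine Measure.AbsolutelyContinuous.mk fun N hN hN0 => ?_
  rw [Measure.restrict_apply hN]
  set A := {x : ℝ | leftEnd k < (x : EReal) ∧ (x : EReal) < rightEnd k}
  -- The point 0 is removed because the lower bound |u| k for the density of σ degenerates there.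
  have hsub : N ∩ A ⊆ (N ∩ A) \ {0} ∪ {0} := by rw [sdiff_union_self]; exact subset_union_left
  refine measure_mono_null hsub (measure_union_null ?_ (hk.measure_singleton_zero hw hkw))
  refine measure_eq_zero_of_volume_eq_zero_of_frequently_le μ
    (measure_mono_null (fun x hx => hx.1.1) hN0) fun u hu => ?_
  have hu0 : u ≠ 0 := hu.2
  obtain ⟨v, r, hv, hr, hle⟩ := hk.exists_dominating_ball hu0 hu.1.2.1 hu.1.2.2
  obtain ⟨C, hC, hev⟩ := exists_eventually_measure_closedBall_le h hk.ae_eq_rnDeriv hv hr hu0 hle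
  exact ⟨C, hC, hev.frequently⟩

/-- The measure `τ` gives no mass to a set outside `0` on which `k` vanishes. -/
lemma IsUnimodalVersion.generatingMeasure_eq_zero (hk : IsUnimodalVersion μ k)
    (hμ : IsBooleanSelfdecomposable μ) {S : Set ℝ} (hS : MeasurableSet S) (h0 : (0 : ℝ) ∉ S)
    (hkS : ∀ x ∈ S, k x = 0) : booleanGeneratingMeasure μ S = 0 := by
  have := hμ.1
  obtain ⟨b, h⟩ := isBooleanGeneratingPair_booleanGeneratingMeasure μ
  have := h.1
  set σ := tilted (booleanGeneratingMeasure μ) with hσ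
  -- On S, σ is absolutely continuous because 0 is excluded, and its density |x| k(x) vanishes
  -- there; σ dominates τ.
  have hac : σ.restrict S ≪ volume := by
    refine Measure.AbsolutelyContinuous.mk fun N hN hN0 => ?_
    rw [Measure.restrict_apply hN]
    exact hμ.tilted_eq_zero_of_volume_eq_zero h (measure_mono_null inter_subset_left hN0)
      fun hx => h0 hx.2
  have hd : (σ.restrict S).rnDeriv volume =ᵐ[volume] 0 := by
    filter_upwards [Measure.rnDeriv_restrict σ volume hS,
      rnDeriv_tilted_ae_eq h hk.ae_eq_rnDeriv] with x h1 h2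
    rw [h1]
    by_cases hx : x ∈ S
    · rw [indicator_of_mem hx, h2, hkS x hx]; simp
    · rw [indicator_of_notMem hx]; rfl
  have hσS : σ S = 0 := by
    rw [← Measure.restrict_apply_univ S, ← Measure.withDensity_rnDeriv_eq _ _ hac,
      withDensity_congr_ae hd]
    simp
  have hle : booleanGeneratingMeasure μ ≤ σ := by
    conv_lhs => rw [← withDensity_one (μ := booleanGeneratingMeasure μ)]
    refine withDensity_mono (ae_of_all _ fun x => ?_)
    rw [Pi.one_apply, ← ENNReal.ofReal_one]
    exact ENNReal.ofReal_le_ofReal (by nlinarith [sq_nonneg x])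
  exact le_antisymm ((hle S).trans hσS.le) zero_le

lemma IsUnimodalVersion.isZeroOrPointMass_left (hk : IsUnimodalVersion μ k)
    (hμ : IsBooleanSelfdecomposable μ) (hle : leftEnd k ≤ 0) (hbot : ⊥ < leftEnd k) :
    IsZeroOrPointMass (μ.restrict {x : ℝ | (x : EReal) ≤ leftEnd k}) := by
  have := hμ.1
  obtain ⟨b, h⟩ := isBooleanGeneratingPair_booleanGeneratingMeasure μ
  obtain ⟨e, he⟩ : ∃ e : ℝ, (e : EReal) = leftEnd k :=
    ⟨_, EReal.coe_toReal (ne_top_of_le_ne_top (by simp) hle) hbot.ne'⟩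
  have he0 : e ≤ 0 := by rw [← he] at hle; exact_mod_cast hle
  rw [← he, show {x : ℝ | (x : EReal) ≤ e} = Iic e by ext x; simp]
  refine isZeroOrPointMass_restrict_Iic h (hk.generatingMeasure_eq_zero hμ measurableSet_Iio
    (by simpa using he0) fun x hx => ?_)
  by_contra hkx
  have hx : x < e := hx
  have h1 := leftEnd_le (hx.trans_le he0).ne hkx
  rw [← he] at h1
  exact absurd hx (not_lt.2 (by exact_mod_cast h1))

lemma IsUnimodalVersion.isZeroOrPointMass_right (hk : IsUnimodalVersion μ k)
    (hμ : IsBooleanSelfdecomposable μ) (hle : 0 ≤ rightEnd k) (htop : rightEnd k < ⊤) :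
    IsZeroOrPointMass (μ.restrict {x : ℝ | rightEnd k ≤ (x : EReal)}) := by
  have := hμ.1
  obtain ⟨b, h⟩ := isBooleanGeneratingPair_booleanGeneratingMeasure μ
  obtain ⟨e, he⟩ : ∃ e : ℝ, (e : EReal) = rightEnd k :=
    ⟨_, EReal.coe_toReal htop.ne (ne_bot_of_le_ne_bot (by simp) hle)⟩
  have he0 : 0 ≤ e := by rw [← he] at hle; exact_mod_cast hle
  rw [← he, show {x : ℝ | (e : EReal) ≤ x} = Ici e by ext x; simp]
  refine isZeroOrPointMass_restrict_Ici h (hk.generatingMeasure_eq_zero hμ measurableSet_Ioi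
    (by simpa using he0) fun x hx => ?_)
  by_contra hkx
  have hx : e < x := hx
  have h1 := le_rightEnd (he0.trans_lt hx).ne' hkx
  rw [← he] at h1
  exact absurd hx (not_lt.2 (by exact_mod_cast h1))

end Version

/-! ### Singular continuous part and number of atoms -/

lemma IsZeroOrPointMass.measure_inter_compl_atoms {μ : Measure ℝ} {S : Set ℝ}
    (h : IsZeroOrPointMass (μ.restrict S)) : μ (S ∩ (atoms μ)ᶜ) = 0 := by
  rcases h with h | ⟨p, m, hm, h⟩
  · exact measure_mono_null inter_subset_left (Measure.restrict_eq_zero.1 h)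
  · have hp : p ∈ atoms μ := by
      intro h0
      have h1 : μ.restrict S {p} = 0 :=
        le_antisymm ((Measure.restrict_apply_le S {p}).trans h0.le) zero_le
      rw [h] at h1
      simp [hm] at h1
    have h2 : μ (S \ {p}) = 0 := by
      rw [sdiff_eq, inter_comm, ← Measure.restrict_apply (measurableSet_singleton p).compl, h]
      simp
    refine measure_mono_null (t := S \ {p}) (fun x hx => ⟨hx.1, fun hxp => hx.2 ?_⟩) h2
    rw [mem_singleton_iff] at hxp
    rwa [hxp]

lemma IsZeroOrPointMass.encard_atoms_inter_le {μ : Measure ℝ} {S : Set ℝ}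
    (h : IsZeroOrPointMass (μ.restrict S)) : (atoms μ ∩ S).encard ≤ 1 := by
  have hx : ∀ x ∈ atoms μ ∩ S, μ.restrict S {x} ≠ 0 := by
    intro x hx
    rw [Measure.restrict_apply (measurableSet_singleton x),
      inter_eq_left.2 (singleton_subset_iff.2 hx.2)]
    exact hx.1
  rcases h with h | ⟨p, m, hm, h⟩
  · rw [eq_empty_of_forall_notMem (s := atoms μ ∩ S) fun x hxm => hx x hxm (by rw [h]; rfl)]
    simp
  · rw [← encard_singleton p]
    refine encard_le_encard fun x hxm => ?_
    by_contra hne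
    refine hx x hxm ?_
    rw [h]
    have : p ≠ x := fun h => hne h.symm
    simp [this]

/-- A measure that is absolutely continuous off two pieces, each zero or a point mass, has no
singular continuous part and at most two atoms. -/
lemma singularContinuousPart_eq_zero_and_encard_atoms_le {μ : Measure ℝ} {A S T : Set ℝ}
    (hcover : A ∪ S ∪ T = univ)
    (hA : μ.restrict A ≪ volume) (hSm : IsZeroOrPointMass (μ.restrict S))
    (hTm : IsZeroOrPointMass (μ.restrict T)) :
    singularContinuousPart μ = 0 ∧ (atoms μ).encard ≤ 2 := by
  have hAN : ∀ N : Set ℝ, MeasurableSet N → volume N = 0 → μ (N ∩ A) = 0 := fun N hN hN0 => by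
    rw [← Measure.restrict_apply hN]; exact hA hN0
  have hmem : ∀ x, x ∈ A ∨ x ∈ S ∨ x ∈ T := fun x => by
    have := mem_univ x
    rwa [← hcover, union_assoc] at this
  constructor
  · rw [singularContinuousPart, Measure.restrict_eq_zero]
    -- The singular part lives on the Lebesgue-null set Nᶜ, and off its atoms μ gives Nᶜ no mass.
    obtain ⟨N, hN, h1, h2⟩ := μ.mutuallySingular_singularPart volume
    have h3 : μ (Nᶜ ∩ (atoms μ)ᶜ) = 0 := by
      refine measure_mono_null (t := Nᶜ ∩ A ∪ (S ∩ (atoms μ)ᶜ ∪ T ∩ (atoms μ)ᶜ)) (fun x hx => ?_)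
        (measure_union_null (hAN _ hN.compl h2) (measure_union_null
          (hSm.measure_inter_compl_atoms) (hTm.measure_inter_compl_atoms)))
      rcases hmem x with h | h | h
      · exact Or.inl ⟨hx.1, h⟩
      · exact Or.inr (Or.inl ⟨h, hx.2⟩)
      · exact Or.inr (Or.inr ⟨h, hx.2⟩)
    have h4 : μ.singularPart volume (Nᶜ ∩ (atoms μ)ᶜ) = 0 :=
      le_antisymm ((Measure.singularPart_le _ _ _).trans h3.le) zero_le
    refine measure_mono_null (fun x hx => ?_) (measure_union_null h1 h4)
    by_cases hxN : x ∈ N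
    · exact Or.inl hxN
    · exact Or.inr ⟨hxN, hx⟩
  · have hsub : atoms μ ⊆ (atoms μ ∩ S) ∪ (atoms μ ∩ T) := by
      intro x hx
      rcases hmem x with h | h | h
      · refine absurd ?_ hx
        have := hAN {x} (measurableSet_singleton x) (by simp)
        rwa [inter_eq_left.2 (singleton_subset_iff.2 h)] at this
      · exact Or.inl ⟨hx, h⟩
      · exact Or.inr ⟨hx, h⟩
    calc (atoms μ).encard ≤ _ := encard_le_encard hsub
      _ ≤ _ := encard_union_le _ _
      _ ≤ 1 + 1 := add_le_add hSm.encard_atoms_inter_le hTm.encard_atoms_inter_le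
      _ = 2 := one_add_one_eq_two

lemma isZeroOrPointMass_restrict_empty (μ : Measure ℝ) : IsZeroOrPointMass (μ.restrict ∅) :=
  Or.inl Measure.restrict_empty

end

theorem mainTheorem1 (μ : Measure ℝ) (hμ : IsBooleanSelfdecomposable μ) :
    (∃ k : ℝ → ℝ, IsUnimodalVersion μ k) ∧
    ∀ k : ℝ → ℝ, IsUnimodalVersion μ k → (∃ x : ℝ, x ≠ 0 ∧ k x ≠ 0) →
      leftEnd k ≤ 0 ∧ 0 ≤ rightEnd k ∧
      μ.restrict {x : ℝ | leftEnd k < (x : EReal) ∧ (x : EReal) < rightEnd k} ≪ volume ∧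
      (⊥ < leftEnd k → IsZeroOrPointMass (μ.restrict {x : ℝ | (x : EReal) ≤ leftEnd k})) ∧
      (rightEnd k < ⊤ → IsZeroOrPointMass (μ.restrict {x : ℝ | rightEnd k ≤ (x : EReal)})) ∧
      μ {0} = 0 ∧
      singularContinuousPart μ = 0 ∧
      (atoms μ).encard ≤ 2 := by
  have := hμ.1
  refine ⟨hμ.exists_isUnimodalVersion, fun k hk hne => ?_⟩
  obtain ⟨w, hw, hkw⟩ := hne
  have hl := hk.leftEnd_nonpos hw hkw
  have hr := hk.rightEnd_nonneg hw hkw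
  have hac := hk.restrict_absolutelyContinuous hw hkw
  have hL := hk.isZeroOrPointMass_left hμ hl
  have hR := hk.isZeroOrPointMass_right hμ hr
  refine ⟨hl, hr, hac, hL, hR, hk.measure_singleton_zero hw hkw, ?_⟩
  -- For an infinite end the corresponding piece is empty, so both cases can be treated alike in the
  -- count of atoms.
  have hL' : IsZeroOrPointMass (μ.restrict {x : ℝ | (x : EReal) ≤ leftEnd k}) := by
    rcases eq_bot_or_bot_lt (leftEnd k) with h | h
    · rw [h, show {x : ℝ | (x : EReal) ≤ ⊥} = ∅ by ext x; simp]
      exact isZeroOrPointMass_restrict_empty μ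
    · exact hL h
  have hR' : IsZeroOrPointMass (μ.restrict {x : ℝ | rightEnd k ≤ (x : EReal)}) := by
    rcases eq_top_or_lt_top (rightEnd k) with h | h
    · rw [h, show {x : ℝ | ⊤ ≤ (x : EReal)} = ∅ by ext x; simp]
      exact isZeroOrPointMass_restrict_empty μ
    · exact hR h
  refine singularContinuousPart_eq_zero_and_encard_atoms_le ?_ hac hL' hR'
  ext x
  simp only [mem_union, mem_ofPred_eq, mem_univ, iff_true]
  rcases lt_or_ge (leftEnd k) (x : EReal) with h1 | h1
  · rcases lt_or_ge (x : EReal) (rightEnd k) with h2 | h2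
    · exact Or.inl (Or.inl ⟨h1, h2⟩)
    · exact Or.inr h2
  · exact Or.inl (Or.inr h1)
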